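/- Let $\mathbf F_q$ be a finite field with $q$ elements, let $G=PGL_2(\mathbf F_q((t^{-1})))$ with its usual locally compact topology, and consider the subgroups $K=PGL_2(\mathbf F_q[[t^{-1}]])$ and $\Gamma=PGL_2(\mathbf F_q[t])$ of $G$. Let $T$ be the Bruhat–Tits tree of $G$: its vertex set is $G/K$, and the neighbours of a vertex $x$ are the vertices $g\begin{pmatrix}t&0\\0&1\end{pmatrix}K$ with $g\in G$, $gK=x$; it is a $(q+1)$-regular tree on which $G$ acts by left translation. The simple random walk on $T$ has transition probabilities $\mu(x,y)=\frac1{q+1}$ if $x,y$ are adjacent and $\mu(x,y)=0$ otherwise. Let $X=\Gamma\backslash T$ be the quotient, equipped with the projected random walk $\overline\mu(\Gamma x,\Gamma y)=\sum_{y'\in\Gamma y}\mu(x,y')$ and with the probability measure $\overline m$ proportional to $\Gamma x\mapsto 1/|\Gamma_x|$, where $\Gamma_x$ is the stabilizer of $x$ in $\Gamma$. Let $$h(X)=\inf_{S}\frac{\sum_{x\in S,\,y\in S^c}\overline m(x)\,\overline\mu(x,y)}{\overline m(S)\,\overline m(S^c)}$$ be its Cheeger constant, where the infimum is over all subsets $S$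 of $X$ such that $S$ and $S^c=X\setminus S$ are non-empty. Then $$h(X)\ \ge\ \min\left\{\frac{q-1}{q+1},\ \frac{4q^2}{(q+1)(q^2-1)}\right\}>0.$$ Moreover, the space $\Gamma\backslash G$, with $G$ acting by $g\cdot\Gamma x=\Gamma xg^{-1}$, carries a $G$-invariant Borel probability measure, and for every such measure $m$ the action of $G$ on $(\Gamma\backslash G,m)$ has the Spectral Gap Property: there exist a compact set $Q\subset G$ and $\varepsilon>0$ such that $$\sup_{s\in Q}\|\pi(s)f-f\|\ \ge\ \varepsilon\|f\|\qquad\text{for all } f\in L^2_0(\Gamma\backslash G,m),$$ where $(\pi(s)f)(x)=f(s^{-1}x)$ and $L^2_0(\Gamma\backslash G,m)$ is the orthogonal complement of the constant functions in the complex Hilbert space $L^2(\Gamma\backslash G,m)$. -/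

import Mathlib

open MeasureTheory Matrix
open scoped LaurentSeries PowerSeries Polynomial ENNReal MatrixGroups

noncomputable section

namespace SpectralGap

/-! ### Markov chains on a countable set and the Cheeger constant -/

/-- The Cheeger constant `h(X)` of a reversible Markov kernel `μ` with stationary probability
measure `m` (given by its point masses): the infimum of
`(∑_{x ∈ S, y ∉ S} m(x) μ(x,y)) / (m(S) m(Sᶜ))`
over all subsets `S` for which the quotient makes sense (`S` and `Sᶜ` both nonempty). -/
def cheegerConstant {X : Type*} (m : X → ℝ) (μ : X → X → ℝ) : ℝ :=
  ⨅ S : {S : Set X // S.Nonempty ∧ Sᶜ.Nonempty},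
    (∑' p : ↥S.1 × ↥S.1ᶜ, m p.1 * μ p.1 p.2) / ((∑' x : ↥S.1, m x) * ∑' x : ↥S.1ᶜ, m x)

section Projection

variable (Γ : Type*) [Group Γ] {V : Type*} [MulAction Γ V]

/-- The kernel on the orbit space `Γ \ V` obtained by projecting a `Γ`-invariant kernel `μ` on `V`:
the probability of going from the orbit of `v` to the orbit `y` is the probability, starting at
`v`, of landing somewhere in `y`. -/
def projectedKernel (μ : V → V → ℝ) (hμ : ∀ (γ : Γ) v w, μ (γ • v) (γ • w) = μ v w) :
    MulAction.orbitRel.Quotient Γ V → MulAction.orbitRel.Quotient Γ V → ℝ := fun x y =>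
  Quotient.liftOn x
    (fun v => ∑' w : {w : V // (Quotient.mk _ w : MulAction.orbitRel.Quotient Γ V) = y}, μ v w)
    (by
      rintro v v' ⟨γ, rfl⟩
      have key : ∀ w : V, (Quotient.mk _ (γ • w) : MulAction.orbitRel.Quotient Γ V)
          = Quotient.mk _ w := fun w => Quotient.sound ⟨γ, rfl⟩
      let e : {w : V // (Quotient.mk _ w : MulAction.orbitRel.Quotient Γ V) = y} ≃
          {w : V // (Quotient.mk _ w : MulAction.orbitRel.Quotient Γ V) = y} :=
        (MulAction.toPerm γ).subtypeEquiv (fun w => by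
          rw [MulAction.toPerm_apply, key])
      refine (e.tsum_eq (fun w => μ (γ • v') (w : V))).symm.trans ?_
      exact tsum_congr fun w => hμ γ v' w)

/-- The measure on the orbit space `Γ \ V` giving the orbit of `v` the mass
`1 / |Γ_v|`, where `Γ_v` is the stabilizer of `v`. -/
def orbitMass : MulAction.orbitRel.Quotient Γ V → ℝ := fun x =>
  Quotient.liftOn x (fun v => 1 / (Nat.card (MulAction.stabilizer Γ v) : ℝ)) (by
    intro v w h
    rw [Nat.card_congr (MulAction.stabilizerEquivStabilizerOfOrbitRel h).toEquiv])

end Projection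

/-! ### The spectral gap property of a probability measure preserving action -/

section Koopman

variable {G X : Type*} [Group G] [MulAction G X] [MeasurableSpace X] [MeasurableConstSMul G X]
  (m : Measure X) [SMulInvariantMeasure G X m]

/-- The Koopman representation on `L²(X, m)`: `(π(g) f)(x) = f(g⁻¹ x)`. -/
def koopman (g : G) : Lp ℂ 2 m →ₗᵢ[ℂ] Lp ℂ 2 m :=
  Lp.compMeasurePreservingₗᵢ ℂ (fun x : X => g⁻¹ • x) (measurePreserving_smul g⁻¹ m)

/-- `L²₀(X, m)`, the orthogonal complement of the constant functions. -/
def LTwoZero (m : Measure X) [IsFiniteMeasure m] : Submodule ℂ (Lp ℂ 2 m) :=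
  (ℂ ∙ (Lp.const 2 m (1 : ℂ)))ᗮ

variable (G) in
/-- The action of `G` on the probability space `(X, m)`, with `m` invariant, has the Spectral Gap
Property: there are a compact set `Q ⊆ G` and `ε > 0` with
`sup_{s ∈ Q} ‖π(s) f - f‖ ≥ ε ‖f‖` for all `f ∈ L²₀(X, m)`. -/
def HasSpectralGapProperty [TopologicalSpace G] [IsProbabilityMeasure m] : Prop :=
  ∃ Q : Set G, IsCompact Q ∧ ∃ ε : ℝ, 0 < ε ∧
    ∀ f ∈ LTwoZero m, ε * ‖f‖ ≤ ⨆ s : Q, ‖koopman m (s : G) f - f‖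

end Koopman

/-! ### The space `Γ \ G` -/

section RightCosets

variable {G : Type*} [Group G]

/-- The space `Γ \ G` of cosets `Γ x`. -/
def CosetSpace (Γ : Subgroup G) : Type _ := Quotient (QuotientGroup.rightRel Γ)

variable {Γ : Subgroup G}

/-- The coset `Γ x`. -/
def CosetSpace.mk (Γ : Subgroup G) (x : G) : CosetSpace Γ :=
  Quotient.mk (QuotientGroup.rightRel Γ) x

/-- `G` acts on `Γ \ G` by `g • Γ x = Γ x g⁻¹`. -/
instance : MulAction G (CosetSpace Γ) where
  smul g := Quotient.map (fun x => x * g⁻¹) (by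
    rintro x y ⟨γ, rfl⟩
    exact ⟨γ, by simp [Subgroup.smul_def, mul_assoc]⟩)
  one_smul := by
    rintro ⟨x⟩
    exact congrArg (CosetSpace.mk Γ) (by simp)
  mul_smul g h := by
    rintro ⟨x⟩
    exact congrArg (CosetSpace.mk Γ) (by simp [mul_assoc])

theorem CosetSpace.smul_mk (g x : G) : g • CosetSpace.mk Γ x = CosetSpace.mk Γ (x * g⁻¹) := rfl

instance [TopologicalSpace G] : TopologicalSpace (CosetSpace Γ) :=
  inferInstanceAs (TopologicalSpace (Quotient (QuotientGroup.rightRel Γ)))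

instance [TopologicalSpace G] : MeasurableSpace (CosetSpace Γ) := borel _

instance [TopologicalSpace G] : BorelSpace (CosetSpace Γ) := ⟨rfl⟩

instance [TopologicalSpace G] [IsTopologicalGroup G] : ContinuousConstSMul G (CosetSpace Γ) where
  continuous_const_smul g := by
    refine continuous_quot_lift _ ?_
    exact continuous_quotient_mk'.comp (continuous_mul_const g⁻¹)

end RightCosets

/-! ### The groups `G = PGL₂(F((t⁻¹)))`, `K = PGL₂(F[[t⁻¹]])`, `Γ = PGL₂(F[t])`

The field `F⸨X⸩` of Laurent series, with its `X`-adic topology, is used with `X = t⁻¹`. -/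

variable (F : Type*) [Field F]

/-- `G = PGL₂(F((t⁻¹)))`. -/
abbrev G : Type _ := PGL(2, F⸨X⸩)

/-- The quotient topology of the topology of `GL₂(F((t⁻¹)))`. -/
instance : TopologicalSpace (G F) :=
  inferInstanceAs (TopologicalSpace (GL (Fin 2) F⸨X⸩ ⧸ Subgroup.center (GL (Fin 2) F⸨X⸩)))

instance : IsTopologicalGroup (G F) :=
  inferInstanceAs (IsTopologicalGroup (GL (Fin 2) F⸨X⸩ ⧸ Subgroup.center (GL (Fin 2) F⸨X⸩)))

/-- The element `t = X⁻¹` of `F((t⁻¹))`. -/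
def t : F⸨X⸩ := HahnSeries.single (-1) 1

theorem t_ne_zero : t F ≠ 0 := by simp [t]

/-- The embedding `F[t] → F((t⁻¹))`. -/
def polyEmb : F[X] →+* F⸨X⸩ := (Polynomial.aeval (t F)).toRingHom

/-- `K = PGL₂(F[[t⁻¹]])`, as a subgroup of `G`. -/
def K : Subgroup (G F) :=
  (ProjGenLinGroup.mk.comp
    (GeneralLinearGroup.map (n := Fin 2) (HahnSeries.ofPowerSeries ℤ F))).range

/-- `Γ = PGL₂(F[t])`, as a subgroup of `G`. -/
def Γ : Subgroup (G F) :=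
  (ProjGenLinGroup.mk.comp (GeneralLinearGroup.map (n := Fin 2) (polyEmb F))).range

/-- The class of the diagonal matrix `diag(t, 1)` in `G`. -/
def a : G F := ProjGenLinGroup.mk
  (GeneralLinearGroup.mkOfDetNeZero !![t F, 0; 0, 1] (by simp [t_ne_zero]))

/-! ### The Bruhat–Tits tree and its simple random walk -/

/-- The vertex set `G / K` of the Bruhat–Tits tree. -/
abbrev Vertex : Type _ := G F ⧸ K F

/-- The Weyl element `(0 1; 1 0)`, in `GL₂` of any commutative ring. -/
def weyl (R : Type*) [CommRing R] : GL (Fin 2) R :=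
  ⟨!![0, 1; 1, 0], !![0, 1; 1, 0], by ext i j; fin_cases i <;> fin_cases j <;> simp,
    by ext i j; fin_cases i <;> fin_cases j <;> simp⟩

theorem weyl_mem_K : ProjGenLinGroup.mk (weyl F⸨X⸩) ∈ K F := by
  refine ⟨weyl F⟦X⟧, ?_⟩
  refine congrArg ProjGenLinGroup.mk ?_
  ext i j
  fin_cases i <;> fin_cases j <;> simp [weyl]

theorem a_weyl_a : a F * ProjGenLinGroup.mk (weyl F⸨X⸩) * a F = ProjGenLinGroup.mk (weyl F⸨X⸩) := by
  rw [a, ← map_mul, ← map_mul, eq_comm, ProjGenLinGroup.mk_eq_mk_iff]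
  refine ⟨Units.mk0 (t F) (t_ne_zero F), ?_⟩
  ext i j
  fin_cases i <;> fin_cases j <;>
    simp [weyl, GeneralLinearGroup.mkOfDetNeZero, Matrix.mul_apply, Fin.sum_univ_two]

theorem order_powerSeries_unit (u : F⟦X⟧ˣ) :
    (HahnSeries.ofPowerSeries ℤ F (u : F⟦X⟧)).order = 0 := by
  have key : ∀ v : F⟦X⟧ˣ, HahnSeries.ofPowerSeries ℤ F (v : F⟦X⟧) ≠ 0 ∧
      (HahnSeries.ofPowerSeries ℤ F (v : F⟦X⟧)).order ≤ 0 := by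
    intro v
    have hv : PowerSeries.coeff 0 (v : F⟦X⟧) ≠ 0 := by
      have := (v.isUnit.map (PowerSeries.constantCoeff (R := F))).ne_zero
      simpa using this
    have h0 : (HahnSeries.ofPowerSeries ℤ F (v : F⟦X⟧)).coeff ((0 : ℕ) : ℤ) ≠ 0 := by
      rw [HahnSeries.ofPowerSeries_apply_coeff]
      exact hv
    exact ⟨fun h => by simp [h] at h0, by simpa using HahnSeries.order_le_of_coeff_ne_zero h0⟩
  have hmul := HahnSeries.order_mul (key u).1 (key u⁻¹).1
  rw [← map_mul, Units.mul_inv, map_one, HahnSeries.order_one] at hmul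
  have h1 := (key u).2
  have h2 := (key u⁻¹).2
  omega

theorem a_notMem_K : a F ∉ K F := by
  rintro ⟨k, hk⟩
  obtain ⟨u, hu⟩ := ProjGenLinGroup.mk_eq_mk_iff.1 hk
  have hd := congrArg (fun g : GL (Fin 2) F⸨X⸩ => (g : Matrix (Fin 2) (Fin 2) F⸨X⸩).det) hu
  have hdet : ((GeneralLinearGroup.map (HahnSeries.ofPowerSeries ℤ F) k :
      GL (Fin 2) F⸨X⸩) : Matrix (Fin 2) (Fin 2) F⸨X⸩).det
      = HahnSeries.ofPowerSeries ℤ F (GeneralLinearGroup.det k : F⟦X⟧ˣ) :=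
    ((HahnSeries.ofPowerSeries ℤ F).map_det (k : Matrix (Fin 2) (Fin 2) F⟦X⟧)).symm
  have hne : HahnSeries.ofPowerSeries ℤ F (GeneralLinearGroup.det k : F⟦X⟧ˣ) ≠ 0 :=
    ((GeneralLinearGroup.det k).isUnit.map (HahnSeries.ofPowerSeries ℤ F)).ne_zero
  have hd' : HahnSeries.ofPowerSeries ℤ F (GeneralLinearGroup.det k : F⟦X⟧ˣ)
      * ((u : F⸨X⸩) * (u : F⸨X⸩)) = t F := by
    rw [← hdet]
    simpa [GeneralLinearGroup.mkOfDetNeZero, Matrix.det_mul, sq] using hd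
  have ho := congrArg HahnSeries.order hd'
  rw [HahnSeries.order_mul hne (mul_ne_zero u.ne_zero u.ne_zero),
    HahnSeries.order_mul u.ne_zero u.ne_zero, order_powerSeries_unit, t,
    HahnSeries.order_single one_ne_zero] at ho
  omega

/-- The graph structure on `G / K`: the neighbours of the vertex `g K` are the vertices
`g k diag(t, 1) K` with `k ∈ K`; these are the `q + 1` vertices `g (t, 0; 0, 1) K` and
`g (t⁻¹, β; 0, 1) K` with `β ∈ F`. -/
def tree : SimpleGraph (Vertex F) where
  Adj x y := ∃ g : G F, x = (g : Vertex F) ∧ y = ((g * a F : G F) : Vertex F)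
  symm := ⟨by
    rintro x y ⟨g, rfl, rfl⟩
    refine ⟨g * a F * ProjGenLinGroup.mk (weyl F⸨X⸩), ?_, ?_⟩
    · exact (QuotientGroup.mk_mul_of_mem _ (weyl_mem_K F)).symm
    · rw [mul_assoc g, mul_assoc g, a_weyl_a]
      exact (QuotientGroup.mk_mul_of_mem _ (weyl_mem_K F)).symm⟩
  loopless := ⟨by
    rintro x ⟨g, h₁, h₂⟩
    rw [h₁, QuotientGroup.eq] at h₂
    exact a_notMem_K F (by simpa using h₂)⟩

variable [Fintype F]

open scoped Classical in
/-- The transition probabilities of the simple random walk on the `(q + 1)`-regular tree. -/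
def treeWalk (x y : Vertex F) : ℝ :=
  if (tree F).Adj x y then 1 / ((Fintype.card F : ℝ) + 1) else 0

theorem treeWalk_smul (γ : Γ F) (x y : Vertex F) :
    treeWalk F (γ • x) (γ • y) = treeWalk F x y := by
  have h : ∀ (g : G F) (x y : Vertex F), (tree F).Adj x y → (tree F).Adj (g • x) (g • y) := by
    rintro g x y ⟨h, rfl, rfl⟩
    exact ⟨g * h, rfl, by rw [mul_assoc]; rfl⟩
  have h' : (tree F).Adj (γ • x) (γ • y) ↔ (tree F).Adj x y :=
    ⟨fun H => by
      have := h (γ : G F)⁻¹ ((γ : G F) • x) ((γ : G F) • y) H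
      rwa [inv_smul_smul, inv_smul_smul] at this,
      h (γ : G F) x y⟩
  unfold treeWalk
  congr 1
  exact propext h'

/-! ### The quotient `X = Γ \ T` -/

/-- The vertex set of the quotient graph `Γ \ T`. -/
abbrev QuotientVertex : Type _ := MulAction.orbitRel.Quotient (Γ F) (Vertex F)

/-- The projection to `Γ \ T` of the simple random walk on `T`. -/
def quotientWalk : QuotientVertex F → QuotientVertex F → ℝ :=
  projectedKernel (Γ F) (treeWalk F) (treeWalk_smul F)

/-- The stationary probability measure of the projected walk: the measure `x ↦ 1 / |Γ_x|`,
normalized to total mass `1`. -/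
def quotientMass (x : QuotientVertex F) : ℝ :=
  orbitMass (Γ F) x / ∑' y : QuotientVertex F, orbitMass (Γ F) y

end SpectralGap

end

open MeasureTheory Matrix
open scoped LaurentSeries PowerSeries Polynomial ENNReal MatrixGroups

noncomputable section

/-! Everything rests on the double coset decomposition of `G` into the sets `Γ aⁿ K`, `n ≥ 0`. They
cover `G` because their union is stable under right multiplication by `K` and `a`, which generate
`G` (`eq_top_of_le`, `exists_inLevel`). They are disjoint by comparing orders of matrix entries:
nonzero polynomials in `t` have order at most `0`, power series in `t⁻¹` order at least `0`
(`eq_of_map_mul_dg_eq`). So the quotient of the tree is a ray. From level `0` all `q + 1` edges go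
to level `1`; from level `n + 1` one edge goes up and `q` go down (`exists_level_kap`).

Counting edges between two orbits in both directions gives detailed balance, so from level `1` on
the masses decay geometrically with ratio `1/q`. A set avoiding level `0` with least level `n + 1`
lies in the tail from `n + 1`, and the single edge between `n + 1` and `n` carries exactly `(q -
1)/(q + 1)` times the tail mass. One of `S`, `Sᶜ` avoids level `0`, which bounds the Cheeger
constant by the first entry of the minimum.

For the invariant measure, `G` is unimodular, and Haar measure is weighted by a function with sum
`1` along each coset `Γ g`; its total mass is finite because the orbit masses are summable.

The spectral gap is proved directly, with `Q = K ∪ {a}`, without the Cheeger constant. A vector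
moved little by `K` is close to a `K`-fixed one (`exists_fixed_of_norm_sub_le`); this is a function
of the level, and a discrete Hardy inequality for the geometrically decaying masses
(`hardy_geometric`) bounds it by its displacement under `a` (`norm_le_of_fixed`). -/

namespace SpectralGap

/-! ### Elementary matrices over a commutative ring -/

section Matrices

variable {R S : Type*} [CommRing R] [CommRing S]

/-- The matrix `(1 b; 0 1)`. -/
def unip (b : R) : GL (Fin 2) R :=
  ⟨!![1, b; 0, 1], !![1, -b; 0, 1], by ext i j; fin_cases i <;> fin_cases j <;> simp,
    by ext i j; fin_cases i <;> fin_cases j <;> simp⟩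

/-- The matrix `(u 0; 0 1)`, as a homomorphism in the unit `u`. -/
def dg : Rˣ →* GL (Fin 2) R where
  toFun u := ⟨!![(u : R), 0; 0, 1], !![((u⁻¹ : Rˣ) : R), 0; 0, 1],
    by ext i j; fin_cases i <;> fin_cases j <;> simp,
    by ext i j; fin_cases i <;> fin_cases j <;> simp⟩
  map_one' := by ext i j; fin_cases i <;> fin_cases j <;> simp
  map_mul' u v := by ext i j; fin_cases i <;> fin_cases j <;> simp

theorem coe_unip (b : R) : (unip b : Matrix (Fin 2) (Fin 2) R) = !![1, b; 0, 1] := rfl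

theorem coe_dg (u : Rˣ) : (dg u : Matrix (Fin 2) (Fin 2) R) = !![(u : R), 0; 0, 1] := rfl

theorem coe_weyl : (weyl R : Matrix (Fin 2) (Fin 2) R) = !![0, 1; 1, 0] := rfl

theorem map_unip (f : R →+* S) (b : R) : GeneralLinearGroup.map f (unip b) = unip (f b) := by
  ext i j; fin_cases i <;> fin_cases j <;> simp [coe_unip]

theorem map_dg (f : R →+* S) (u : Rˣ) :
    GeneralLinearGroup.map (n := Fin 2) f (dg u) = dg (Units.map f u) := by
  ext i j; fin_cases i <;> fin_cases j <;> simp [coe_dg]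

theorem map_weyl (f : R →+* S) : GeneralLinearGroup.map f (weyl R) = weyl S := by
  ext i j; fin_cases i <;> fin_cases j <;> simp [coe_weyl]

theorem weyl_mul_weyl : weyl R * weyl R = 1 := by
  ext i j; fin_cases i <;> fin_cases j <;> simp [coe_weyl]

theorem unip_inv (b : R) : (unip b)⁻¹ = unip (-b) := by
  rw [inv_eq_iff_mul_eq_one]
  ext i j; fin_cases i <;> fin_cases j <;> simp [coe_unip]

theorem dg_mul_unip (u : Rˣ) (b : R) : dg u * unip b = unip (u * b) * dg u := by
  ext i j; fin_cases i <;> fin_cases j <;> simp [coe_unip, coe_dg]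

end Matrices

/-! ### Generation of `G` by `K` and `a` -/

section Generators

variable (F : Type*) [Field F]

/-- The element `t`, as a unit. -/
def tUnit : F⸨X⸩ˣ := Units.mk0 (t F) (t_ne_zero F)

/-- The image of `GL₂(F[[t⁻¹]])` in `G`. -/
def ofPS : GL (Fin 2) F⟦X⟧ →* G F :=
  ProjGenLinGroup.mk.comp (GeneralLinearGroup.map (n := Fin 2) (HahnSeries.ofPowerSeries ℤ F))

/-- The image of `GL₂(F[t])` in `G`. -/
def ofPoly : GL (Fin 2) F[X] →* G F :=
  ProjGenLinGroup.mk.comp (GeneralLinearGroup.map (n := Fin 2) (polyEmb F))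

variable {F}

theorem mem_K {g : G F} : g ∈ K F ↔ ∃ k, ofPS F k = g := Iff.rfl

theorem ofPS_mem (k : GL (Fin 2) F⟦X⟧) : ofPS F k ∈ K F := ⟨k, rfl⟩

theorem ofPoly_mem (k : GL (Fin 2) F[X]) : ofPoly F k ∈ Γ F := ⟨k, rfl⟩

theorem ofPS_apply (k : GL (Fin 2) F⟦X⟧) :
    ofPS F k = ProjGenLinGroup.mk (GeneralLinearGroup.map (HahnSeries.ofPowerSeries ℤ F) k) := rfl

theorem ofPoly_apply (k : GL (Fin 2) F[X]) :
    ofPoly F k = ProjGenLinGroup.mk (GeneralLinearGroup.map (polyEmb F) k) := rfl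

theorem a_eq : a F = ProjGenLinGroup.mk (dg (tUnit F)) := by
  rw [a]
  congr 1
  ext i j
  fin_cases i <;> fin_cases j <;> simp [GeneralLinearGroup.mkOfDetNeZero, coe_dg, tUnit]

theorem a_zpow (n : ℤ) : a F ^ n = ProjGenLinGroup.mk (dg (tUnit F ^ n)) := by
  rw [a_eq, map_zpow, map_zpow]

theorem a_pow (n : ℕ) : a F ^ n = ProjGenLinGroup.mk (dg (tUnit F ^ n)) := by
  rw [a_eq, map_pow, map_pow]

theorem t_zpow (n : ℤ) : (t F) ^ n = HahnSeries.single (-n) 1 := by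
  have hinv : HahnSeries.single (1 : ℤ) (1 : F) = (t F)⁻¹ := by
    refine eq_inv_of_mul_eq_one_left ?_
    rw [t, HahnSeries.single_mul_single]
    simp
  have h := RatFunc.single_zpow (F := F) (-n)
  rw [h, hinv, _root_.inv_zpow', neg_neg]

/-- The class of the Weyl element in `G`. -/
def w (F : Type*) [Field F] : G F := ProjGenLinGroup.mk (weyl F⸨X⸩)

theorem w_eq_ofPS : w F = ofPS F (weyl _) := by rw [ofPS_apply, map_weyl, w]

theorem w_eq_ofPoly : w F = ofPoly F (weyl _) := by rw [ofPoly_apply, map_weyl, w]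

theorem w_mem_K : w F ∈ K F := weyl_mem_K F

theorem w_mem_Gam : w F ∈ Γ F := by rw [w_eq_ofPoly]; exact ofPoly_mem _

theorem w_mul_w : w F * w F = 1 := by rw [w, ← map_mul, weyl_mul_weyl, map_one]

theorem a_w_a : a F * w F * a F = w F := a_weyl_a F

theorem a_inv : (a F)⁻¹ = w F * a F * w F := by
  rw [inv_eq_iff_mul_eq_one, ← mul_assoc, ← mul_assoc, a_w_a, w_mul_w]

theorem a_zpow_mul_unip (n : ℤ) (b : F⸨X⸩) :
    a F ^ n * ProjGenLinGroup.mk (unip b) = ProjGenLinGroup.mk (unip (t F ^ n * b)) * a F ^ n := by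
  rw [a_zpow, ← map_mul, ← map_mul, dg_mul_unip]
  simp [tUnit]

theorem isUnit_powerSeriesPart {x : F⸨X⸩} (hx : x ≠ 0) :
    IsUnit (LaurentSeries.powerSeriesPart x) := by
  rw [PowerSeries.isUnit_iff_constantCoeff, isUnit_iff_ne_zero,
    ← PowerSeries.coeff_zero_eq_constantCoeff_apply, LaurentSeries.powerSeriesPart_coeff]
  simpa using HahnSeries.coeff_order_eq_zero.not.2 hx

theorem eq_t_zpow_mul (x : F⸨X⸩) : x = t F ^ (-x.order) *
    HahnSeries.ofPowerSeries ℤ F (LaurentSeries.powerSeriesPart x) := by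
  rw [t_zpow, neg_neg, LaurentSeries.single_order_mul_powerSeriesPart]

/-- Conjugation by a power of `a` multiplies the off-diagonal entry by a power of `t`, which makes
it integral. -/
theorem unip_mem_of_le {H : Subgroup (G F)} (hK : K F ≤ H) (ha : a F ∈ H) (b : F⸨X⸩) :
    ProjGenLinGroup.mk (unip b) ∈ H := by
  have h := a_zpow_mul_unip (-b.order)
    (HahnSeries.ofPowerSeries ℤ F (LaurentSeries.powerSeriesPart b))
  rw [← eq_t_zpow_mul] at h
  rw [← mul_inv_eq_iff_eq_mul.2 h]
  refine H.mul_mem (H.mul_mem (H.zpow_mem ha _) (hK ?_)) (H.inv_mem (H.zpow_mem ha _))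
  rw [← map_unip, ← ofPS_apply]
  exact ofPS_mem _

theorem dg_mem_of_le {H : Subgroup (G F)} (hK : K F ≤ H) (ha : a F ∈ H) (u : F⸨X⸩ˣ) :
    ProjGenLinGroup.mk (dg u) ∈ H := by
  obtain ⟨v, hv⟩ := isUnit_powerSeriesPart u.ne_zero
  have hu : u = tUnit F ^ (-(u : F⸨X⸩).order) *
      Units.map (HahnSeries.ofPowerSeries ℤ F : F⟦X⟧ →* F⸨X⸩) v := by
    ext1
    have := eq_t_zpow_mul (u : F⸨X⸩)
    rw [← hv] at this
    simpa [tUnit] using this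
  rw [hu, map_mul, map_mul, ← a_zpow]
  refine H.mul_mem (H.zpow_mem ha _) (hK ?_)
  rw [mem_K]
  exact ⟨dg v, by rw [ofPS_apply, map_dg]⟩

/-- Over a field, diagonal matrices and transvections generate. Modulo scalars a diagonal matrix is
a `dg`, and the Weyl element of `K` turns lower transvections into upper ones. -/
theorem eq_top_of_le {H : Subgroup (G F)} (hK : K F ≤ H) (ha : a F ∈ H) : H = ⊤ := by
  rw [eq_top_iff]
  rintro g -
  induction g using ProjGenLinGroup.induction_on with | mk g => ?_
  let P : Matrix (Fin 2) (Fin 2) F⸨X⸩ → Prop := fun M =>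
    ∀ g : GL (Fin 2) F⸨X⸩, (g : Matrix (Fin 2) (Fin 2) F⸨X⸩) = M → ProjGenLinGroup.mk g ∈ H
  suffices h : P g from h g rfl
  refine Matrix.diagonal_transvection_induction_of_det_ne_zero P _ g.det_ne_zero ?_ ?_ ?_
  · intro D hD g hg
    rw [det_diagonal, Fin.prod_univ_two, mul_ne_zero_iff] at hD
    have : ProjGenLinGroup.mk g =
        ProjGenLinGroup.mk (dg (Units.mk0 (D 0 / D 1) (div_ne_zero hD.1 hD.2))) := by
      rw [eq_comm, ProjGenLinGroup.mk_eq_mk_iff]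
      refine ⟨Units.mk0 (D 1) hD.2, ?_⟩
      ext i j
      fin_cases i <;> fin_cases j <;> simp [hg, coe_dg, hD.2]
    rw [this]
    exact dg_mem_of_le hK ha _
  · rintro ⟨i, j, hij, c⟩ g hg
    have hw : ProjGenLinGroup.mk (weyl F⸨X⸩) ∈ H := hK (weyl_mem_K F)
    have : g = unip c ∨ g = weyl _ * unip c * weyl _ := by
      fin_cases i <;> fin_cases j
      · simp at hij
      · left
        ext i j
        fin_cases i <;> fin_cases j <;> simp [hg, coe_unip, TransvectionStruct.toMatrix,
          transvection, single]
      · right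
        ext i j
        fin_cases i <;> fin_cases j <;> simp [hg, coe_unip, coe_weyl, TransvectionStruct.toMatrix,
          transvection, single]
      · simp at hij
    rcases this with rfl | rfl
    · exact unip_mem_of_le hK ha c
    · rw [map_mul, map_mul]
      exact H.mul_mem (H.mul_mem hw (unip_mem_of_le hK ha c)) hw
  · intro A B hA hB PA PB g hg
    have : g = GeneralLinearGroup.mkOfDetNeZero A hA * GeneralLinearGroup.mkOfDetNeZero B hB := by
      ext i j
      simp [hg, GeneralLinearGroup.mkOfDetNeZero]
    rw [this, map_mul]
    exact H.mul_mem (PA _ rfl) (PB _ rfl)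

end Generators

/-! ### Orders of Laurent series and disjointness of the double cosets -/

section Orders

variable {F : Type*} [Field F]

theorem order_ofPowerSeries_nonneg (f : F⟦X⟧) : 0 ≤ (HahnSeries.ofPowerSeries ℤ F f).order := by
  by_contra! h
  have h0 : HahnSeries.ofPowerSeries ℤ F f ≠ 0 := by
    intro h0
    simp [h0] at h
  refine HahnSeries.coeff_order_eq_zero.not.2 h0 ?_
  have := PowerSeries.coeff_coe f (HahnSeries.ofPowerSeries ℤ F f).order
  rwa [if_pos h] at this

theorem polyEmb_eq_sum (p : F[X]) :
    polyEmb F p = p.sum fun i c => HahnSeries.single (-(i : ℤ)) c := by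
  change Polynomial.aeval (t F) p = _
  rw [Polynomial.aeval_eq_sum_range, Polynomial.sum_over_range _ (by simp)]
  refine Finset.sum_congr rfl fun i _ => ?_
  have := t_zpow (F := F) i
  rw [zpow_natCast] at this
  rw [this, Algebra.smul_def, LaurentSeries.algebraMap_apply]
  simp [HahnSeries.C_apply, HahnSeries.single_mul_single]

theorem coeff_polyEmb (p : F[X]) (n : ℕ) : (polyEmb F p).coeff (-(n : ℤ)) = p.coeff n := by
  induction p using Polynomial.induction_on' with
  | add p q hp hq => simp [hp, hq]
  | monomial i c =>
    rw [polyEmb_eq_sum, Polynomial.sum_monomial_index _ _ (by simp), HahnSeries.coeff_single,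
      Polynomial.coeff_monomial]
    simp [eq_comm]

theorem polyEmb_ne_zero {p : F[X]} (hp : p ≠ 0) : polyEmb F p ≠ 0 := fun h => by
  have := coeff_polyEmb p p.natDegree
  simp [h] at this
  exact hp (Polynomial.leadingCoeff_eq_zero.1 this.symm)

theorem order_polyEmb_le {p : F[X]} (hp : p ≠ 0) : (polyEmb F p).order ≤ -(p.natDegree : ℤ) :=
  HahnSeries.order_le_of_coeff_ne_zero (by rw [coeff_polyEmb]; simpa)

/-- The orders of `u` and `u⁻¹` are both at most `0` and add up to `0`. -/
theorem order_polyEmb_unit (u : F[X]ˣ) : (polyEmb F (u : F[X])).order = 0 := by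
  have h (v : F[X]ˣ) : (polyEmb F (v : F[X])).order ≤ 0 :=
    (order_polyEmb_le v.ne_zero).trans (by simp)
  have hmul := HahnSeries.order_mul (polyEmb_ne_zero u.ne_zero) (polyEmb_ne_zero (u⁻¹).ne_zero)
  rw [← map_mul, Units.mul_inv, map_one, HahnSeries.order_one] at hmul
  have h1 := h u
  have h2 := h u⁻¹
  omega

theorem order_t_pow (n : ℕ) : (t F ^ n).order = -(n : ℤ) := by
  rw [← zpow_natCast, t_zpow, HahnSeries.order_single one_ne_zero]

theorem det_map_ne_zero {R : Type*} [CommRing R] (f : R →+* F⸨X⸩) (k : GL (Fin 2) R) :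
    ((GeneralLinearGroup.map f k : GL (Fin 2) F⸨X⸩) : Matrix (Fin 2) (Fin 2) F⸨X⸩).det ≠ 0 :=
  GeneralLinearGroup.det_ne_zero _

theorem det_map {R : Type*} [CommRing R] (f : R →+* F⸨X⸩) (k : GL (Fin 2) R) :
    ((GeneralLinearGroup.map f k : GL (Fin 2) F⸨X⸩) : Matrix (Fin 2) (Fin 2) F⸨X⸩).det =
      f (GeneralLinearGroup.det k : Rˣ) :=
  (f.map_det (k : Matrix (Fin 2) (Fin 2) R)).symm

theorem entries_of_mul_dg_eq {R : Type*} [CommRing R] {A B : GL (Fin 2) R} {x y u : Rˣ}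
    (h : A * dg x = dg y * B * GeneralLinearGroup.scalar (Fin 2) u) :
    A 0 0 * x = y * B 0 0 * u ∧ A 0 1 = y * B 0 1 * u ∧ A 1 0 * x = B 1 0 * u ∧
      A 1 1 = B 1 1 * u := by
  have hent (i j) := congrArg (fun g : GL (Fin 2) R => g i j) h
  have h00 := hent 0 0
  have h01 := hent 0 1
  have h10 := hent 1 0
  have h11 := hent 1 1
  simp [coe_dg, mul_apply, vecMul] at h00 h01 h10 h11
  exact ⟨h00, h01, h10, h11⟩

/-- The only double cosets `Γ aⁿ K`, `Γ aᵐ K` that meet are the equal ones; moreover the scalar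
relating two representing matrices is a unit of `F[[t⁻¹]]`. -/
theorem eq_of_map_mul_dg_eq {M : GL (Fin 2) F[X]} {k : GL (Fin 2) F⟦X⟧} {u : F⸨X⸩ˣ} {n m : ℕ}
    (h : GeneralLinearGroup.map (polyEmb F) M * dg (tUnit F ^ n) =
      dg (tUnit F ^ m) * GeneralLinearGroup.map (HahnSeries.ofPowerSeries ℤ F) k *
        GeneralLinearGroup.scalar (Fin 2) u) :
    n = m ∧ (u : F⸨X⸩).order = 0 := by
  obtain ⟨h00, -, h10, h11⟩ := entries_of_mul_dg_eq h
  simp only [GeneralLinearGroup.map_apply, Units.val_pow_eq_pow_val, tUnit, Units.val_mk0]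
    at h00 h10 h11
  have hd := congrArg (fun g : GL (Fin 2) F⸨X⸩ => (g : Matrix (Fin 2) (Fin 2) F⸨X⸩).det) h
  simp only [GeneralLinearGroup.coe_mul, det_mul, det_map] at hd
  simp [coe_dg, tUnit] at hd
  have ht : t F ≠ 0 := t_ne_zero F
  have hu : (u : F⸨X⸩) ≠ 0 := u.ne_zero
  have hkd : HahnSeries.ofPowerSeries ℤ F (GeneralLinearGroup.det k : F⟦X⟧ˣ) ≠ 0 := by
    rw [← det_map]; exact det_map_ne_zero _ _
  have hMd : polyEmb F (GeneralLinearGroup.det M : F[X]ˣ) ≠ 0 := polyEmb_ne_zero (Units.ne_zero _)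
  have ho := congrArg HahnSeries.order hd
  simp only [GeneralLinearGroup.val_det_apply] at ho hkd hMd
  rw [HahnSeries.order_mul hMd (pow_ne_zero _ ht), order_t_pow,
    HahnSeries.order_mul (mul_ne_zero (pow_ne_zero _ ht) hkd) (pow_ne_zero _ hu),
    HahnSeries.order_mul (pow_ne_zero _ ht) hkd, order_t_pow, sq, HahnSeries.order_mul hu hu,
    ← GeneralLinearGroup.val_det_apply, ← GeneralLinearGroup.val_det_apply,
    order_polyEmb_unit, order_powerSeries_unit] at ho
  -- A nonzero polynomial has order at most `0` and a power series order at least `0`, so each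
  -- nonzero entry of `M` yields an inequality.
  have key {p : F[X]} {f : F⟦X⟧} {x y : F⸨X⸩} (hx : x ≠ 0) (hy : y ≠ 0)
      (h : polyEmb F p * x = y * HahnSeries.ofPowerSeries ℤ F f * u) (hp : p ≠ 0) :
      y.order + (u : F⸨X⸩).order ≤ x.order := by
    have hl := mul_ne_zero (polyEmb_ne_zero hp) hx
    have hf : HahnSeries.ofPowerSeries ℤ F f ≠ 0 := by
      rw [h] at hl
      exact fun h0 => hl (by rw [h0]; ring)
    have ho := congrArg HahnSeries.order h
    rw [HahnSeries.order_mul (polyEmb_ne_zero hp) hx, HahnSeries.order_mul (mul_ne_zero hy hf) hu,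
      HahnSeries.order_mul hy hf] at ho
    have h1 := order_polyEmb_le hp
    have h2 := order_ofPowerSeries_nonneg f
    omega
  have k00 := key (pow_ne_zero n ht) (pow_ne_zero m ht) h00
  have k10 := key (y := 1) (pow_ne_zero n ht) one_ne_zero (by rw [one_mul]; exact h10)
  have k11 := key (x := 1) (y := 1) one_ne_zero one_ne_zero (by rw [one_mul, mul_one]; exact h11)
  simp only [order_t_pow, HahnSeries.order_one] at k00 k10 k11
  have hdet : (M : Matrix (Fin 2) (Fin 2) F[X]).det ≠ 0 := M.det_ne_zero
  rw [det_fin_two] at hdet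
  -- Let `d` be the order of `u`; determinants give `m = n + 2d`. If `M 1 0 ≠ 0` then `d ≤ -n`, and
  -- `n, m ≥ 0` force `d = 0`. Otherwise both diagonal entries are nonzero, giving `d ≥ 0` and `d ≤
  -- 0`.
  have hu0 : (u : F⸨X⸩).order = 0 := by
    by_contra hu0
    have hr : M 1 0 = 0 := by
      by_contra hr
      have := k10 hr
      have hp : M 0 0 ≠ 0 ∨ M 1 1 ≠ 0 := by
        by_contra! hp
        have := k00
        omega
      omega
    by_cases hs : M 1 1 = 0
    · exact hdet (by rw [hr, hs]; ring)
    by_cases hp : M 0 0 = 0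
    · exact hdet (by rw [hr, hp]; ring)
    have := k00 hp
    have := k11 hs
    omega
  exact ⟨by omega, hu0⟩

theorem t_mul_X : t F * HahnSeries.ofPowerSeries ℤ F PowerSeries.X = 1 := by
  rw [HahnSeries.ofPowerSeries_X, t, HahnSeries.single_mul_single]
  simp

theorem polyEmb_X : polyEmb F Polynomial.X = t F := Polynomial.aeval_X _

theorem polyEmb_C (b : F) :
    polyEmb F (Polynomial.C b) = HahnSeries.ofPowerSeries ℤ F (PowerSeries.C b) := by
  refine (Polynomial.aeval_C _ _).trans ?_
  rw [LaurentSeries.algebraMap_apply, HahnSeries.ofPowerSeries_C]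

end Orders

/-! ### The neighbours of a vertex as points of the projective line -/

section Neighbours

variable {F : Type*} [Field F]

/-- Determinants show that the scalar `u` has order `0`; the lower left entry of the conjugate is
then `t * k 1 0` up to that scalar, which is integral only if `k 1 0` has no constant term. Together
with the converse below, `K ∩ a K a⁻¹` consists of the matrices that are upper triangular modulo
`t⁻¹`. -/
theorem constantCoeff_eq_zero_of_conj_mem {k : GL (Fin 2) F⟦X⟧}
    (h : (a F)⁻¹ * ofPS F k * a F ∈ K F) : PowerSeries.constantCoeff (k 1 0) = 0 := by
  obtain ⟨k', hk'⟩ := h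
  change ofPS F k' = _ at hk'
  rw [mul_assoc, eq_inv_mul_iff_mul_eq, a_eq, ofPS_apply, ofPS_apply, ← map_mul, ← map_mul,
    ProjGenLinGroup.mk_eq_mk_iff] at hk'
  obtain ⟨u, hu⟩ := hk'
  have hd := congrArg (fun g : GL (Fin 2) F⸨X⸩ => (g : Matrix (Fin 2) (Fin 2) F⸨X⸩).det) hu
  obtain ⟨-, -, h10, -⟩ := entries_of_mul_dg_eq hu.symm
  simp only [GeneralLinearGroup.coe_mul, det_mul, det_map] at hd
  simp only [GeneralLinearGroup.map_apply, tUnit, Units.val_mk0] at h10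
  have ht : t F ≠ 0 := t_ne_zero F
  have hu0 : (u : F⸨X⸩) ≠ 0 := u.ne_zero
  have hps (k : GL (Fin 2) F⟦X⟧) :
      HahnSeries.ofPowerSeries ℤ F (GeneralLinearGroup.det k : F⟦X⟧ˣ) ≠ 0 := by
    rw [← det_map]; exact det_map_ne_zero _ _
  have hd' : HahnSeries.ofPowerSeries ℤ F (GeneralLinearGroup.det k' : F⟦X⟧ˣ) * (u * u) =
      HahnSeries.ofPowerSeries ℤ F (GeneralLinearGroup.det k : F⟦X⟧ˣ) := by
    have h1 : (dg (tUnit F) : Matrix (Fin 2) (Fin 2) F⸨X⸩).det = t F := by simp [coe_dg, tUnit]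
    have h2 : (GeneralLinearGroup.scalar (Fin 2) u : Matrix (Fin 2) (Fin 2) F⸨X⸩).det = u * u := by
      simp [sq]
    rw [h1, h2] at hd
    refine mul_left_cancel₀ ht ?_
    linear_combination hd
  have ho := congrArg HahnSeries.order hd'
  rw [HahnSeries.order_mul (hps _) (mul_ne_zero hu0 hu0), HahnSeries.order_mul hu0 hu0,
    order_powerSeries_unit, order_powerSeries_unit] at ho
  by_contra hc
  obtain ⟨v, hv⟩ := PowerSeries.isUnit_iff_constantCoeff.2 (isUnit_iff_ne_zero.2 hc)
  have hv0 : HahnSeries.ofPowerSeries ℤ F (v : F⟦X⟧) ≠ 0 :=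
    (v.isUnit.map (HahnSeries.ofPowerSeries ℤ F)).ne_zero
  rw [← hv] at h10
  have hk10 : HahnSeries.ofPowerSeries ℤ F (k' 1 0) ≠ 0 := fun h0 => by
    rw [h0, zero_mul] at h10
    exact mul_ne_zero hv0 ht h10
  have ho' := congrArg HahnSeries.order h10
  rw [HahnSeries.order_mul hv0 ht, HahnSeries.order_mul hk10 hu0, order_powerSeries_unit, t,
    HahnSeries.order_single one_ne_zero] at ho'
  have := order_ofPowerSeries_nonneg (k' 1 0)
  omega

theorem conj_mem_of_constantCoeff_eq_zero {k : GL (Fin 2) F⟦X⟧}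
    (h : PowerSeries.constantCoeff (k 1 0) = 0) : (a F)⁻¹ * ofPS F k * a F ∈ K F := by
  obtain ⟨r, hr⟩ := PowerSeries.X_dvd_iff.2 h
  have hdet : IsUnit (!![k 0 0, PowerSeries.X * k 0 1; r, k 1 1]).det := by
    convert (GeneralLinearGroup.det k).isUnit using 1
    rw [GeneralLinearGroup.val_det_apply, det_fin_two_of, det_fin_two k.1, hr]
    ring
  obtain ⟨k', hk'⟩ : ∃ k' : GL (Fin 2) F⟦X⟧, (k' : Matrix (Fin 2) (Fin 2) F⟦X⟧) =
    !![k 0 0, PowerSeries.X * k 0 1; r, k 1 1] := ⟨GeneralLinearGroup.mk'' _ hdet, rfl⟩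
  refine ⟨k', ?_⟩
  change ofPS F _ = _
  rw [mul_assoc, eq_inv_mul_iff_mul_eq, a_eq, ofPS_apply, ofPS_apply, ← map_mul, ← map_mul]
  refine congrArg ProjGenLinGroup.mk ?_
  have hX := t_mul_X (F := F)
  refine GeneralLinearGroup.ext fun i j => ?_
  fin_cases i <;> fin_cases j <;>
    simp [coe_dg, hk', mul_apply, tUnit]
  · ring
  · rw [← mul_assoc, ← HahnSeries.ofPowerSeries_X, hX, one_mul]
  · rw [hr, map_mul, mul_right_comm, mul_comm _ (t F), hX, one_mul]

/-- Coset representatives of `K ∩ a K a⁻¹` in `K`. -/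
def kap : Option F → G F
  | none => 1
  | some b => ofPS F (unip (PowerSeries.C b) * weyl _)

theorem kap_none : kap (none : Option F) = 1 := rfl

theorem kap_mem : ∀ i : Option F, kap i ∈ K F
  | none => one_mem _
  | some _ => ofPS_mem _

/-- The coset is determined by the first column modulo `t⁻¹`, as a point of the projective line over
`F`: `none` is the point at infinity `(1 : 0)` and `some b` is `(b : 1)`. -/
theorem exists_kap {k : G F} (hk : k ∈ K F) : ∃ i : Option F, (kap i * a F)⁻¹ * (k * a F) ∈ K F := by
  obtain ⟨k, rfl⟩ := hk
  change ∃ i : Option F, (kap i * a F)⁻¹ * (ofPS F k * a F) ∈ K F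
  by_cases h : PowerSeries.constantCoeff (k 1 0) = 0
  · refine ⟨none, ?_⟩
    simpa [kap, mul_assoc] using conj_mem_of_constantCoeff_eq_zero h
  · set b := PowerSeries.constantCoeff (k 0 0) / PowerSeries.constantCoeff (k 1 0)
    refine ⟨some b, ?_⟩
    have : (kap (some b) * a F)⁻¹ * (ofPS F k * a F) =
        (a F)⁻¹ * ofPS F ((unip (PowerSeries.C b) * weyl _)⁻¹ * k) * a F := by
      rw [kap, map_mul (ofPS F) (_)⁻¹, map_inv]
      group
    rw [this]
    refine conj_mem_of_constantCoeff_eq_zero ?_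
    rw [_root_.mul_inv_rev, unip_inv, inv_eq_of_mul_eq_one_left (weyl_mul_weyl (R := F⟦X⟧))]
    simp [coe_weyl, coe_unip, mul_apply, b]
    field_simp
    simp

theorem kap_injective {i j : Option F} (h : (kap i * a F)⁻¹ * (kap j * a F) ∈ K F) : i = j := by
  have key {k : GL (Fin 2) F⟦X⟧} (hk : ofPS F k = (kap i)⁻¹ * kap j) :
      PowerSeries.constantCoeff (k 1 0) = 0 := by
    refine constantCoeff_eq_zero_of_conj_mem ?_
    rw [hk]
    convert h using 1
    group
  rcases i with _ | b <;> rcases j with _ | c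
  · rfl
  · have := key (k := unip (PowerSeries.C c) * weyl _) (by simp [kap])
    simp [coe_weyl, coe_unip] at this
  · have := key (k := (unip (PowerSeries.C b) * weyl _)⁻¹) (by simp [kap])
    rw [_root_.mul_inv_rev, unip_inv, inv_eq_of_mul_eq_one_left (weyl_mul_weyl (R := F⟦X⟧))] at this
    simp [coe_weyl, coe_unip] at this
  · have := key (k := (unip (PowerSeries.C b) * weyl _)⁻¹ * (unip (PowerSeries.C c) * weyl _))
      (by simp [kap])
    rw [_root_.mul_inv_rev, unip_inv, inv_eq_of_mul_eq_one_left (weyl_mul_weyl (R := F⟦X⟧))] at this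
    simp [coe_weyl, coe_unip] at this
    rw [add_neg_eq_zero.1 this]

end Neighbours

/-! ### The level of an element of `G` -/

section Level

variable {F : Type*} [Field F]

/-- The double coset `Γ aⁿ K`. -/
def InLevel (n : ℕ) (g : G F) : Prop := ∃ γ ∈ Γ F, ∃ k ∈ K F, g = γ * a F ^ n * k

theorem InLevel.mul_left {n : ℕ} {g γ : G F} (h : InLevel n g) (hγ : γ ∈ Γ F) :
    InLevel n (γ * g) := by
  obtain ⟨γ', h', k, hk, rfl⟩ := h
  exact ⟨γ * γ', mul_mem hγ h', k, hk, by group⟩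

theorem InLevel.mul_right {n : ℕ} {g k : G F} (h : InLevel n g) (hk : k ∈ K F) :
    InLevel n (g * k) := by
  obtain ⟨γ, hγ, k', hk', rfl⟩ := h
  exact ⟨γ, hγ, k' * k, mul_mem hk' hk, by group⟩

theorem InLevel.congr_right {n : ℕ} {g h : G F} (hg : InLevel n g) (hk : g⁻¹ * h ∈ K F) :
    InLevel n h := by
  simpa using hg.mul_right hk

theorem inLevel_a_pow (n : ℕ) : InLevel n (a F ^ n) := ⟨1, one_mem _, 1, one_mem _, by simp⟩

theorem w_mul_a : w F * a F = (a F)⁻¹ * w F := by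
  rw [eq_inv_mul_iff_mul_eq, ← mul_assoc, a_w_a]

theorem a_pow_mul_unip (n : ℕ) (b : F⸨X⸩) :
    a F ^ n * ProjGenLinGroup.mk (unip b) = ProjGenLinGroup.mk (unip (t F ^ n * b)) * a F ^ n := by
  simpa only [zpow_natCast] using a_zpow_mul_unip (n : ℤ) b

/-- Moving `aⁿ⁺¹` past the unipotent factor turns `b` into the polynomial `tⁿ⁺¹ b`, so that factor
lies in `Γ`; then `w a = a⁻¹ w` cancels one power of `a`. -/
theorem inLevel_a_pow_kap (n : ℕ) (b : F) :
    InLevel n (a F ^ (n + 1) * kap (some b) * a F) := by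
  refine ⟨ofPoly F (unip (Polynomial.X ^ (n + 1) * Polynomial.C b)), ofPoly_mem _, w F, w_mem_K, ?_⟩
  have h := a_pow_mul_unip (n + 1) (HahnSeries.ofPowerSeries ℤ F (PowerSeries.C b))
  have h2 : polyEmb F (Polynomial.X ^ (n + 1) * Polynomial.C b) =
      t F ^ (n + 1) * HahnSeries.ofPowerSeries ℤ F (PowerSeries.C b) := by
    rw [map_mul, map_pow, polyEmb_X, polyEmb_C]
  rw [kap, map_mul, ← w_eq_ofPS, ofPoly_apply, ofPS_apply, map_unip, map_unip, h2, ← mul_assoc]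
  rw [h, mul_assoc, mul_assoc, w_mul_a, pow_succ (a F)]
  group

theorem inLevel_kap (b : F) : InLevel 1 (kap (some b) * a F) := by
  refine ⟨ofPoly F (unip (Polynomial.C b)) * w F, mul_mem (ofPoly_mem _) w_mem_Gam, 1, one_mem _, ?_⟩
  rw [kap, map_mul, ← w_eq_ofPS, ofPoly_apply, ofPS_apply, map_unip, map_unip, polyEmb_C]
  group

theorem inLevel_succ_or {n : ℕ} {g : G F} (h : InLevel n g) :
    InLevel (n + 1) (g * a F) ∨ InLevel 1 (g * a F) ∨ ∃ m, n = m + 1 ∧ InLevel m (g * a F) := by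
  obtain ⟨γ, hγ, k, hk, rfl⟩ := h
  obtain ⟨i, hi⟩ := exists_kap hk
  have key {m : ℕ} (hm : InLevel m (a F ^ n * kap i * a F)) :
      InLevel m (γ * a F ^ n * k * a F) := by
    refine (hm.mul_left hγ).congr_right ?_
    convert hi using 1
    group
  rcases i with _ | b
  · exact .inl (key (by simpa [kap, ← pow_succ] using inLevel_a_pow (n + 1)))
  · rcases n with _ | n
    · exact .inr (.inl (key (by simpa using inLevel_kap b)))
    · exact .inr (.inr ⟨n, rfl, key (inLevel_a_pow_kap n b)⟩)

/-- The elements whose right translations, along with those of their inverses, preserve the union of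
the double cosets form a subgroup. It contains `K` and `a`; for `a⁻¹` use `a⁻¹ = w a w`. -/
theorem exists_inLevel (g : G F) : ∃ n, InLevel n g := by
  let H : Subgroup (G F) :=
    { carrier := {x | ∀ g : G F, (∃ n, InLevel n g) → (∃ n, InLevel n (g * x)) ∧
        ∃ n, InLevel n (g * x⁻¹)}
      mul_mem' := fun {x y} hx hy g hg =>
        ⟨by rw [← mul_assoc]; exact (hy _ (hx _ hg).1).1,
          by rw [_root_.mul_inv_rev, ← mul_assoc]; exact (hx _ (hy _ hg).2).2⟩
      one_mem' := fun g hg => by simpa using hg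
      inv_mem' := fun {x} hx g hg => by simpa using (hx g hg).symm }
  have hK : K F ≤ H := fun k hk g ⟨n, hn⟩ => ⟨⟨n, hn.mul_right hk⟩, n, hn.mul_right (inv_mem hk)⟩
  have ha' : ∀ g : G F, (∃ n, InLevel n g) → ∃ n, InLevel n (g * a F) := by
    rintro g ⟨n, hn⟩
    rcases inLevel_succ_or hn with h | h | ⟨m, -, h⟩
    exacts [⟨_, h⟩, ⟨_, h⟩, ⟨_, h⟩]
  have ha : a F ∈ H := fun g hg => by
    refine ⟨ha' g hg, ?_⟩
    obtain ⟨n, hn⟩ := hg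
    rw [a_inv, ← mul_assoc, ← mul_assoc]
    obtain ⟨m, hm⟩ := ha' _ ⟨n, hn.mul_right w_mem_K⟩
    exact ⟨m, hm.mul_right w_mem_K⟩
  have hg : g ∈ H := by rw [eq_top_of_le hK ha]; trivial
  simpa using (hg 1 ⟨0, by simpa using inLevel_a_pow (F := F) 0⟩).1

/-- A relation `γ aⁿ = aᵐ k` in `G`, lifted to `GL₂`. -/
theorem exists_lift {n m : ℕ} {γ k : G F} (hγ : γ ∈ Γ F) (hk : k ∈ K F)
    (h : γ * a F ^ n = a F ^ m * k) : ∃ M κ u, ofPoly F M = γ ∧ ofPS F κ = k ∧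
    GeneralLinearGroup.map (polyEmb F) M * dg (tUnit F ^ n) =
      dg (tUnit F ^ m) * GeneralLinearGroup.map (HahnSeries.ofPowerSeries ℤ F) κ *
        GeneralLinearGroup.scalar (Fin 2) u := by
  obtain ⟨M, rfl⟩ := hγ
  obtain ⟨κ, rfl⟩ := hk
  change ofPoly F M * _ = _ * ofPS F κ at h
  rw [a_pow, a_pow, ofPoly_apply, ofPS_apply, ← map_mul, ← map_mul, eq_comm,
    ProjGenLinGroup.mk_eq_mk_iff] at h
  obtain ⟨u, hu⟩ := h
  exact ⟨M, κ, u, rfl, rfl, hu.symm⟩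

theorem InLevel.unique {n m : ℕ} {g : G F} (hn : InLevel n g) (hm : InLevel m g) : n = m := by
  obtain ⟨γ, hγ, k, hk, rfl⟩ := hn
  obtain ⟨γ', hγ', k', hk', h⟩ := hm
  obtain ⟨M, κ, u, -, -, h⟩ := exists_lift (n := n) (m := m) (mul_mem (inv_mem hγ') hγ)
    (mul_mem hk' (inv_mem hk)) (by
      rw [mul_assoc, inv_mul_eq_iff_eq_mul, ← mul_assoc, ← mul_assoc, ← h]; group)
  exact (eq_of_map_mul_dg_eq h).1

/-- The index of the double coset of `Γ \ G / K` containing `g`. -/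
def level (g : G F) : ℕ := (exists_inLevel g).choose

theorem inLevel_level (g : G F) : InLevel (level g) g := (exists_inLevel g).choose_spec

theorem InLevel.level_eq {n : ℕ} {g : G F} (h : InLevel n g) : level g = n :=
  (inLevel_level g).unique h

theorem level_mul_left {γ : G F} (hγ : γ ∈ Γ F) (g : G F) : level (γ * g) = level g :=
  ((inLevel_level g).mul_left hγ).level_eq

theorem level_mul_right {k : G F} (hk : k ∈ K F) (g : G F) : level (g * k) = level g :=
  ((inLevel_level g).mul_right hk).level_eq

theorem level_a_pow (n : ℕ) : level (a F ^ n) = n := (inLevel_a_pow n).level_eq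

theorem exists_of_level_eq {g h : G F} (e : level g = level h) :
    ∃ γ ∈ Γ F, ∃ k ∈ K F, h = γ * g * k := by
  obtain ⟨γ, hγ, k, hk, hg⟩ := inLevel_level g
  obtain ⟨γ', hγ', k', hk', hh⟩ := inLevel_level h
  refine ⟨γ' * γ⁻¹, mul_mem hγ' (inv_mem hγ), k⁻¹ * k', mul_mem (inv_mem hk) hk', ?_⟩
  rw [← e] at hh
  generalize level g = n at *
  rw [hh, hg]
  group

theorem level_kap_of_zero {g : G F} (h : level g = 0) (i : Option F) :
    level (g * kap i * a F) = 1 := by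
  have := (inLevel_level g).mul_right (kap_mem i)
  rw [h] at this
  rcases inLevel_succ_or this with h | h | ⟨m, h, -⟩
  · exact h.level_eq
  · exact h.level_eq
  · omega

/-- Of the `q + 1` neighbours of a vertex of level `n + 1`, one has level `n + 2` and the others have
level `n`. -/
theorem exists_level_kap {n : ℕ} {g : G F} (h : level g = n + 1) :
    ∃ i₀ : Option F, level (g * kap i₀ * a F) = n + 2 ∧
      ∀ i ≠ i₀, level (g * kap i * a F) = n := by
  obtain ⟨γ, hγ, k, hk, hg⟩ := inLevel_level g
  rw [h] at hg
  -- The upward neighbour is the one that `k` carries to the direction `none`, hence the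
  -- representative of `k⁻¹`.
  obtain ⟨i₀, hi₀⟩ := exists_kap (inv_mem hk)
  have key (i j : Option F) (hj : (kap j * a F)⁻¹ * (k * kap i * a F) ∈ K F) :
      level (g * kap i * a F) = level (a F ^ (n + 1) * kap j * a F) := by
    rw [hg, ← level_mul_left hγ (a F ^ (n + 1) * kap j * a F), eq_comm, ← level_mul_right hj]
    congr 1
    group
  refine ⟨i₀, ?_, fun i hi => ?_⟩
  · rw [key i₀ none]
    · simpa [kap, ← pow_succ] using level_a_pow (F := F) (n + 2)
    · convert inv_mem hi₀ using 1
      rw [kap_none]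
      group
  · obtain ⟨j, hj⟩ := exists_kap (mul_mem hk (kap_mem i))
    rw [key i j hj]
    rcases j with _ | b
    · refine absurd (kap_injective ?_) hi
      convert inv_mem (mul_mem hi₀ hj) using 1
      rw [kap_none]
      group
    · exact (inLevel_a_pow_kap n b).level_eq

end Level

/-! ### A Cheeger bound for chains indexed by the natural numbers -/

section Cheeger

/-- One of `S`, `Sᶜ` misses the origin of the ray. If `n + 1` is its least index, it lies in the
tail from `n + 1`, while the edge between `n` and `n + 1` crosses the boundary. That edge alone
suffices, since the other mass is at most `1`. -/
theorem le_cheegerConstant {X : Type*} (e : X ≃ ℕ) {m : X → ℝ} {μ : X → X → ℝ} {c : ℝ} (hc : 0 ≤ c)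
    (hm : ∀ x, 0 < m x) (hμ : ∀ x y, 0 ≤ μ x y) (hs : Summable m) (hm1 : ∑' x, m x ≤ 1)
    (hp : Summable fun p : X × X => m p.1 * μ p.1 p.2)
    (hdown : ∀ n, c * ∑' x, {x | n + 1 ≤ e x}.indicator m x ≤
      m (e.symm (n + 1)) * μ (e.symm (n + 1)) (e.symm n))
    (hup : ∀ n, c * ∑' x, {x | n + 1 ≤ e x}.indicator m x ≤
      m (e.symm n) * μ (e.symm n) (e.symm (n + 1))) :
    c ≤ cheegerConstant m μ := by
  have hne : Nonempty {S : Set X // S.Nonempty ∧ Sᶜ.Nonempty} :=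
    ⟨⟨{e.symm 0}, ⟨_, rfl⟩, e.symm 1, by simp⟩⟩
  refine le_ciInf fun ⟨S, hS, hSc⟩ => ?_
  have hpos (U : Set X) (hU : U.Nonempty) : 0 < ∑' x : U, m x := by
    obtain ⟨x, hx⟩ := hU
    exact (hs.subtype U).tsum_pos (fun y => (hm y.1).le) ⟨x, hx⟩ (hm x)
  have hle1 (U : Set X) : ∑' x : U, m x ≤ 1 :=
    (Summable.tsum_subtype_le m U (fun x => (hm x).le) hs).trans hm1
  have htail (U : Set X) (n : ℕ) (hU : ∀ x ∈ U, n ≤ e x) :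
      ∑' x : U, m x ≤ ∑' x, {x | n ≤ e x}.indicator m x := by
    rw [tsum_subtype]
    exact Summable.tsum_le_tsum (fun x => Set.indicator_le_indicator_of_subset hU (fun y => (hm y).le) x)
      (hs.indicator _) (hs.indicator _)
  have hflow (x y : X) (hx : x ∈ S) (hy : y ∈ Sᶜ) :
      m x * μ x y ≤ ∑' p : ↥S × ↥Sᶜ, m p.1 * μ p.1 p.2 := by
    have hinj : Function.Injective fun p : ↥S × ↥Sᶜ => ((p.1 : X), (p.2 : X)) := by
      rintro ⟨a, b⟩ ⟨c, d⟩ h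
      simp only [Prod.mk.injEq] at h
      exact Prod.ext (Subtype.ext h.1) (Subtype.ext h.2)
    exact (hp.comp_injective hinj).le_tsum (⟨x, hx⟩, ⟨y, hy⟩)
      fun p _ => mul_nonneg (hm _).le (hμ _ _)
  have hmin (U : Set X) (hU : U.Nonempty) (h0 : e.symm 0 ∉ U) :
      ∃ n, e.symm (n + 1) ∈ U ∧ e.symm n ∉ U ∧ ∀ x ∈ U, n + 1 ≤ e x := by
    classical
    have hex : ∃ n, e.symm n ∈ U := by
      obtain ⟨x, hx⟩ := hU
      exact ⟨e x, by simpa⟩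
    obtain ⟨n, hn⟩ := Nat.exists_eq_succ_of_ne_zero (n := Nat.find hex) fun h => by
      have := Nat.find_spec hex
      rw [h] at this
      exact h0 this
    refine ⟨n, ?_, Nat.find_min hex (by omega), fun x hx => ?_⟩
    · have := Nat.find_spec hex
      rwa [hn] at this
    · have := Nat.find_min' hex (m := e x) (by simpa)
      omega
  rw [le_div_iff₀ (mul_pos (hpos S hS) (hpos _ hSc))]
  by_cases h0 : e.symm 0 ∈ S
  · obtain ⟨n, h1, h2, h3⟩ := hmin Sᶜ hSc (by simpa)
    refine le_trans ?_ ((hup n).trans (hflow _ _ (by simpa using h2) h1))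
    refine mul_le_mul_of_nonneg_left ?_ hc
    exact (mul_le_of_le_one_left (hpos _ hSc).le (hle1 S)).trans (htail _ _ h3)
  · obtain ⟨n, h1, h2, h3⟩ := hmin S hS h0
    refine le_trans ?_ ((hdown n).trans (hflow _ _ h1 h2))
    refine mul_le_mul_of_nonneg_left ?_ hc
    exact (mul_le_of_le_one_right (hpos _ hS).le (hle1 _)).trans (htail _ _ h3)

end Cheeger

/-! ### Double counting of edges between two orbits -/

section Reversibility

variable {Γ V : Type*} [Group Γ] [MulAction Γ V]

/-- The map `γ ↦ γ • w` has cosets of the stabilizer of `w` as fibres. Since this is a bijection, no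
finiteness is needed. -/
theorem card_rel_mul_card_stabilizer (R : V → V → Prop) (v w : V) :
    Nat.card {w' : V // (Quotient.mk _ w' : MulAction.orbitRel.Quotient Γ V) = Quotient.mk _ w ∧
      R v w'} * Nat.card (MulAction.stabilizer Γ w) = Nat.card {γ : Γ // R v (γ • w)} := by
  rw [← Nat.card_prod]
  have hex (p : {w' : V // (Quotient.mk _ w' : MulAction.orbitRel.Quotient Γ V) = Quotient.mk _ w ∧
      R v w'}) : ∃ γ : Γ, γ • w = p.1 := Quotient.exact p.2.1
  choose σ hσ using hex
  have hmk (γ : Γ) : (Quotient.mk _ (γ • w) : MulAction.orbitRel.Quotient Γ V) = Quotient.mk _ w :=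
    Quotient.sound ⟨γ, rfl⟩
  refine Nat.card_congr
    { toFun := fun p => ⟨σ p.1 * p.2, by
        rw [mul_smul, MulAction.mem_stabilizer_iff.1 p.2.2, hσ]; exact p.1.2.2⟩
      invFun := fun γ => (⟨γ.1 • w, hmk _, γ.2⟩, ⟨(σ ⟨γ.1 • w, hmk _, γ.2⟩)⁻¹ * γ.1, by
        rw [MulAction.mem_stabilizer_iff, mul_smul, inv_smul_eq_iff, hσ]⟩)
      left_inv := ?_
      right_inv := fun γ => by simp }
  rintro ⟨⟨p, hp⟩, ⟨s, hs⟩⟩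
  have : (σ ⟨p, hp⟩ * s) • w = p := by rw [mul_smul, MulAction.mem_stabilizer_iff.1 hs, hσ]
  simp [this]

/-- Inversion of `γ` exchanges the sets counted for `(v, w)` and `(w, v)`. -/
theorem card_rel_mul_card_stabilizer_comm (R : V → V → Prop)
    (hR : ∀ (γ : Γ) v w, R (γ • v) (γ • w) ↔ R v w) (hs : ∀ v w, R v w → R w v) (v w : V) :
    Nat.card {w' : V // (Quotient.mk _ w' : MulAction.orbitRel.Quotient Γ V) = Quotient.mk _ w ∧
      R v w'} * Nat.card (MulAction.stabilizer Γ w) =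
    Nat.card {v' : V // (Quotient.mk _ v' : MulAction.orbitRel.Quotient Γ V) = Quotient.mk _ v ∧
      R w v'} * Nat.card (MulAction.stabilizer Γ v) := by
  rw [card_rel_mul_card_stabilizer, card_rel_mul_card_stabilizer]
  have key (v w : V) (γ : Γ) (h : R v (γ • w)) : R w (γ⁻¹ • v) := by
    have := (hR γ⁻¹ _ _).2 (hs _ _ h)
    rwa [inv_smul_smul] at this
  exact Nat.card_congr ((Equiv.inv Γ).subtypeEquiv fun γ => ⟨key v w γ, fun h => by
    simpa using key w v _ h⟩)

end Reversibility

/-! ### The quotient ray and its transition probabilities -/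

section Ray

variable {F : Type*} [Field F]

theorem adj_iff {g : G F} {y : Vertex F} :
    (tree F).Adj (g : Vertex F) y ↔ ∃ i : Option F, ((g * kap i * a F : G F) : Vertex F) = y := by
  constructor
  · rintro ⟨g', hg, rfl⟩
    rw [QuotientGroup.eq] at hg
    obtain ⟨i, hi⟩ := exists_kap hg
    refine ⟨i, ?_⟩
    rw [QuotientGroup.eq]
    convert hi using 1
    group
  · rintro ⟨i, rfl⟩
    refine ⟨g * kap i, ?_, rfl⟩
    rw [QuotientGroup.eq]
    simpa using kap_mem i

theorem nb_injective (g : G F) :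
    Function.Injective fun i : Option F => ((g * kap i * a F : G F) : Vertex F) := fun i j h => by
  rw [QuotientGroup.eq] at h
  refine kap_injective ?_
  convert h using 1
  group

/-- The orbit of the vertex `g K`. -/
def qmk (g : G F) : QuotientVertex F := Quotient.mk _ (g : Vertex F)

theorem exists_qmk (x : QuotientVertex F) : ∃ g : G F, qmk g = x := by
  induction x using Quotient.inductionOn with | h v => ?_
  induction v using QuotientGroup.induction_on with | H g => exact ⟨g, rfl⟩

theorem qmk_eq_qmk {g h : G F} : qmk g = qmk h ↔ level g = level h := by
  constructor
  · intro e
    obtain ⟨γ, hγ⟩ := Quotient.exact e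
    change ((γ.1 * h : G F) : Vertex F) = _ at hγ
    rw [QuotientGroup.eq] at hγ
    rw [← level_mul_left γ.2 h, ← level_mul_right hγ (γ.1 * h)]
    congr 1
    group
  · intro e
    obtain ⟨γ, hγ, k, hk, rfl⟩ := exists_of_level_eq e
    refine (Quotient.sound ⟨⟨γ, hγ⟩, ?_⟩ : qmk (γ * g * k) = qmk g).symm
    exact (QuotientGroup.mk_mul_of_mem _ hk).symm

/-- The level of an orbit of vertices. -/
def qlevel (x : QuotientVertex F) : ℕ := level (exists_qmk x).choose

theorem qlevel_qmk (g : G F) : qlevel (qmk g) = level g :=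
  qmk_eq_qmk.1 (exists_qmk (qmk g)).choose_spec

/-- The quotient `Γ \ T` is a ray. -/
def qEquiv (F : Type*) [Field F] : QuotientVertex F ≃ ℕ where
  toFun := qlevel
  invFun n := qmk (a F ^ n)
  left_inv x := by
    obtain ⟨g, rfl⟩ := exists_qmk x
    rw [qmk_eq_qmk, level_a_pow, qlevel_qmk]
  right_inv n := by rw [qlevel_qmk, level_a_pow]

theorem qmk_eq_iff {g : G F} {x : QuotientVertex F} : qmk g = x ↔ level g = qlevel x := by
  obtain ⟨h, rfl⟩ := exists_qmk x
  rw [qmk_eq_qmk, qlevel_qmk]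

/-- The order of the stabilizer in `Γ` of the vertex `g K`. -/
def cardStab (g : G F) : ℕ := Nat.card (MulAction.stabilizer (Γ F) (g : Vertex F))

theorem orbitMass_qmk (g : G F) : orbitMass (Γ F) (qmk g) = 1 / (cardStab g : ℝ) := rfl

variable [Fintype F]

/-- The number of neighbours of `g K` of level `n`. -/
def cnt (g : G F) (n : ℕ) : ℕ := Fintype.card {i : Option F // level (g * kap i * a F) = n}

theorem card_adj (g : G F) (x : QuotientVertex F) :
    Nat.card {w : Vertex F // (Quotient.mk _ w : QuotientVertex F) = x ∧
      (tree F).Adj (g : Vertex F) w} = cnt g (qlevel x) := by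
  rw [cnt, ← Nat.card_eq_fintype_card, eq_comm]
  refine Nat.card_congr (Equiv.ofBijective (fun i => ⟨((g * kap i.1 * a F : G F) : Vertex F),
    qmk_eq_iff.2 i.2, adj_iff.2 ⟨_, rfl⟩⟩) ⟨fun i j h => ?_, ?_⟩)
  · exact Subtype.ext (nb_injective g (congrArg Subtype.val h))
  · rintro ⟨w, hw, hadj⟩
    obtain ⟨i, rfl⟩ := adj_iff.1 hadj
    exact ⟨⟨i, qmk_eq_iff.1 hw⟩, rfl⟩

/-- Detailed balance, the source of all the stabilizer orders below. -/
theorem cnt_mul_cardStab (g h : G F) :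
    cnt g (level h) * cardStab h = cnt h (level g) * cardStab g := by
  rw [← qlevel_qmk g, ← qlevel_qmk h, ← card_adj, ← card_adj]
  refine card_rel_mul_card_stabilizer_comm (tree F).Adj (fun γ v w => ?_) (fun v w h => h.symm) _ _
  have h' : ∀ (γ : Γ F) (x y : Vertex F), (tree F).Adj x y → (tree F).Adj (γ • x) (γ • y) := by
    rintro γ x y ⟨h, rfl, rfl⟩
    exact ⟨γ * h, rfl, by rw [mul_assoc]; rfl⟩
  exact ⟨fun h => by simpa using h' γ⁻¹ _ _ h, h' γ v w⟩

theorem quotientWalk_qmk (g : G F) (x : QuotientVertex F) :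
    quotientWalk F (qmk g) x = cnt g (qlevel x) / ((Fintype.card F : ℝ) + 1) := by
  classical
  change ∑' w : {w : Vertex F // (Quotient.mk _ w : QuotientVertex F) = x},
    treeWalk F (g : Vertex F) w = _
  have h1 := tsum_subtype {w : Vertex F | (Quotient.mk _ w : QuotientVertex F) = x}
    (treeWalk F (g : Vertex F))
  refine h1.trans ?_
  rw [← (nb_injective g).tsum_eq, tsum_fintype]
  · have h2 (i : Option F) : Set.indicator {w : Vertex F | (Quotient.mk _ w : QuotientVertex F) = x}
        (treeWalk F (g : Vertex F)) ((g * kap i * a F : G F) : Vertex F) =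
        if level (g * kap i * a F) = qlevel x then 1 / ((Fintype.card F : ℝ) + 1) else 0 := by
      have h3 : treeWalk F (g : Vertex F) ((g * kap i * a F : G F) : Vertex F) =
        1 / ((Fintype.card F : ℝ) + 1) := if_pos (adj_iff.2 ⟨i, rfl⟩)
      rw [Set.indicator_apply, h3]
      exact if_congr qmk_eq_iff rfl rfl
    rw [Finset.sum_congr rfl fun i _ => h2 i, ← Finset.sum_filter, Finset.sum_const, cnt,
      Fintype.card_subtype, nsmul_eq_mul, mul_one_div]
  · intro w hw
    have : treeWalk F (g : Vertex F) w ≠ 0 := by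
      intro h
      refine hw ?_
      rw [Set.indicator_apply, h, ite_self]
    rw [treeWalk] at this
    obtain ⟨i, hi⟩ := adj_iff.1 (Classical.byContradiction fun h => this (if_neg h))
    exact ⟨i, hi⟩

theorem cnt_zero {g : G F} (h : level g = 0) : cnt g 1 = Fintype.card F + 1 := by
  rw [cnt, ← Fintype.card_option]
  exact Fintype.card_congr (Equiv.subtypeUnivEquiv fun i => level_kap_of_zero h i)

theorem cnt_up {g : G F} {n : ℕ} (h : level g = n + 1) : cnt g (n + 2) = 1 := by
  obtain ⟨i₀, h1, h2⟩ := exists_level_kap h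
  rw [cnt, Fintype.card_eq_one_iff]
  refine ⟨⟨i₀, h1⟩, fun ⟨i, hi⟩ => Subtype.ext ?_⟩
  by_contra hne
  have := h2 i hne
  omega

theorem cnt_down {g : G F} {n : ℕ} (h : level g = n + 1) : cnt g n = Fintype.card F := by
  classical
  obtain ⟨i₀, h1, h2⟩ := exists_level_kap h
  have : Fintype.card {i : Option F // i ≠ i₀} = Fintype.card F := by
    rw [Fintype.card_subtype_compl, Fintype.card_option, Fintype.card_subtype_eq, Nat.add_sub_cancel]
  rw [cnt, ← this]
  refine Fintype.card_congr (Equiv.subtypeEquivRight fun i => ⟨?_, h2 i⟩)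
  rintro hi rfl
  omega

theorem sum_cnt_le (g : G F) (s : Finset ℕ) : ∑ n ∈ s, cnt g n ≤ Fintype.card F + 1 := by
  classical
  rw [← Fintype.card_option, ← Finset.card_univ]
  simp only [cnt, Fintype.card_subtype]
  rw [← Finset.card_biUnion]
  · exact Finset.card_le_univ _
  · intro m _ n _ hmn
    rw [Function.onFun, Finset.disjoint_filter]
    rintro i - rfl
    exact hmn

end Ray

theorem tsum_mul_le_of_sum_le_one {X : Type*} {μ : X → ℝ} {c : ℝ} (hc : 0 ≤ c) (hμ : ∀ y, 0 ≤ μ y)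
    (hμ1 : ∀ s : Finset X, ∑ y ∈ s, μ y ≤ 1) : ∑' y, c * μ y ≤ c := by
  rw [_root_.tsum_mul_left]
  exact mul_le_of_le_one_right hc ((summable_of_sum_le hμ hμ1).tsum_le_of_sum_le hμ1)

theorem summable_mul_of_sum_le_one {X : Type*} {m : X → ℝ} {μ : X → X → ℝ} (hm : ∀ x, 0 ≤ m x)
    (hs : Summable m) (hμ : ∀ x y, 0 ≤ μ x y) (hμ1 : ∀ x (s : Finset X), ∑ y ∈ s, μ x y ≤ 1) :
    Summable fun p : X × X => m p.1 * μ p.1 p.2 := by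
  have h0 : (0 : X × X → ℝ) ≤ fun p => m p.1 * μ p.1 p.2 := fun p => mul_nonneg (hm _) (hμ _ _)
  rw [summable_prod_of_nonneg h0]
  constructor
  · intro x
    exact (summable_of_sum_le (hμ x) (hμ1 x)).mul_left (m x)
  · have h1 : ∀ x, 0 ≤ ∑' y, m x * μ x y := fun x => tsum_nonneg fun y => mul_nonneg (hm x) (hμ x y)
    exact Summable.of_nonneg_of_le h1 (fun x => tsum_mul_le_of_sum_le_one (hm x) (hμ x) (hμ1 x)) hs

/-! ### Stabilizer orders, orbit masses and the Cheeger constant of the ray -/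

section RayMass

variable {F : Type*} [Field F]

theorem polyEmb_eq_C {p : F[X]} {x : F⸨X⸩} {f : F⟦X⟧} (hx : x.order = 0)
    (h : polyEmb F p = HahnSeries.ofPowerSeries ℤ F f * x) : p = Polynomial.C (p.coeff 0) := by
  refine Polynomial.eq_C_of_natDegree_eq_zero ?_
  by_cases hp : p = 0
  · simp [hp]
  have h0 := polyEmb_ne_zero hp
  have h1 := order_polyEmb_le hp
  rw [h] at h0 h1
  rw [HahnSeries.order_mul (left_ne_zero_of_mul h0) (right_ne_zero_of_mul h0), hx] at h1
  have := order_ofPowerSeries_nonneg f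
  omega

theorem qEquiv_symm_apply (n : ℕ) : (qEquiv F).symm n = qmk (a F ^ n) := rfl

variable [Fintype F]

/-- Lifted to matrices, an element is polynomial and, up to a scalar of order `0`, integral. Its
entries are therefore constants, which leaves finitely many matrices. -/
theorem finite_Gam_inter_K : (Γ F ⊓ K F : Set (G F)).Finite := by
  classical
  let φ : Matrix (Fin 2) (Fin 2) F → G F := fun A =>
    if h : ∃ M : GL (Fin 2) F[X], (M : Matrix (Fin 2) (Fin 2) F[X]) = A.map Polynomial.C then
      ofPoly F h.choose else 1
  refine (Set.finite_range φ).subset ?_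
  rintro g ⟨hg, hk⟩
  obtain ⟨M, κ, u, hM, -, h⟩ := exists_lift (n := 0) (m := 0) hg hk (by simp)
  have hu := (eq_of_map_mul_dg_eq h).2
  simp only [pow_zero, map_one, mul_one, one_mul] at h
  have hent (i j) : M i j = Polynomial.C ((M i j).coeff 0) := by
    have := congrArg (fun g : GL (Fin 2) F⸨X⸩ => g i j) h
    refine polyEmb_eq_C (f := κ i j) hu ?_
    simpa using this
  have hex : ∃ M' : GL (Fin 2) F[X], (M' : Matrix (Fin 2) (Fin 2) F[X]) =
      (Matrix.of fun i j => (M i j).coeff 0).map Polynomial.C :=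
    ⟨M, by ext1 i j; exact hent i j⟩
  refine ⟨Matrix.of fun i j => (M i j).coeff 0, ?_⟩
  simp only [φ]
  rw [dif_pos hex, ← hM]
  refine congrArg (ofPoly F) (Units.ext ?_)
  rw [hex.choose_spec]
  ext1 i j
  exact (hent i j).symm

/-- `Nat.card` is `0` for an infinite group, so positivity is finiteness of the stabilizer. Detailed
balance then carries it to all levels. -/
theorem cardStab_one_pos : 0 < cardStab (1 : G F) := by
  have : Finite (MulAction.stabilizer (Γ F) ((1 : G F) : Vertex F)) := by
    have := finite_Gam_inter_K (F := F).to_subtype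
    refine Finite.of_injective
      (fun γ => (⟨γ.1.1, γ.1.2, ?_⟩ : (Γ F ⊓ K F : Set (G F)))) fun γ γ' h => ?_
    · have := MulAction.mem_stabilizer_iff.1 γ.2
      change ((γ.1.1 * 1 : G F) : Vertex F) = _ at this
      rw [eq_comm, QuotientGroup.eq] at this
      simpa using this
    · have h' : γ.1.1 = γ'.1.1 := congrArg (fun x : (Γ F ⊓ K F : Set (G F)) => x.1) h
      exact Subtype.ext (Subtype.ext h')
  exact Nat.card_pos

theorem cardStab_one_mul : Fintype.card F * cardStab (1 : G F) =
    (Fintype.card F + 1) * cardStab (a F) := by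
  have h1 : level (1 : G F) = 0 := by simpa using level_a_pow (F := F) 0
  have h2 : level (a F) = 1 := by simpa using level_a_pow (F := F) 1
  have := cnt_mul_cardStab (1 : G F) (a F)
  rw [h1, h2, cnt_zero h1, cnt_down (n := 0) h2] at this
  exact this.symm

theorem cardStab_succ (n : ℕ) :
    cardStab (a F ^ (n + 1)) = Fintype.card F ^ n * cardStab (a F) := by
  induction n with
  | zero => simp
  | succ n ih =>
    have := cnt_mul_cardStab (a F ^ (n + 1)) (a F ^ (n + 2))
    rw [level_a_pow, level_a_pow, cnt_up (level_a_pow _), cnt_down (level_a_pow _)] at this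
    rw [← one_mul (cardStab _), this, ih, pow_succ]
    ring

theorem cardStab_a_pos : 0 < cardStab (a F) := by
  have h := cardStab_one_mul (F := F)
  have h1 := cardStab_one_pos (F := F)
  have hq : 0 < Fintype.card F := Fintype.card_pos
  by_contra h0
  rw [Nat.eq_zero_of_not_pos h0, mul_zero] at h
  exact (mul_pos hq h1).ne' h

theorem cardStab_pow_pos (n : ℕ) : 0 < cardStab (a F ^ n) := by
  rcases n with _ | n
  · simpa using cardStab_one_pos (F := F)
  · rw [cardStab_succ]
    exact mul_pos (pow_pos Fintype.card_pos _) cardStab_a_pos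

theorem orbitMass_pos (x : QuotientVertex F) : 0 < orbitMass (Γ F) x := by
  obtain ⟨n, rfl⟩ := (qEquiv F).symm.surjective x
  rw [qEquiv_symm_apply, orbitMass_qmk]
  have := cardStab_pow_pos (F := F) n
  positivity

theorem orbitMass_succ (n : ℕ) : orbitMass (Γ F) (qmk (a F ^ (n + 1))) =
    (1 / (cardStab (a F) : ℝ)) * (1 / (Fintype.card F : ℝ)) ^ n := by
  rw [orbitMass_qmk, cardStab_succ]
  push_cast
  rw [_root_.one_div_pow, one_div_mul_one_div, mul_comm]

theorem two_le_card : (2 : ℝ) ≤ Fintype.card F := by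
  exact_mod_cast Fintype.one_lt_card (α := F)

theorem hasSum_orbitMass_tail (n : ℕ) :
    HasSum (fun j => orbitMass (Γ F) (qmk (a F ^ (j + (n + 1)))))
      (orbitMass (Γ F) (qmk (a F ^ (n + 1))) *
        ((Fintype.card F : ℝ) / (Fintype.card F - 1))) := by
  have hq := two_le_card (F := F)
  have h := (hasSum_geometric_of_lt_one (r := 1 / (Fintype.card F : ℝ)) (by positivity)
    (by rw [div_lt_one] <;> linarith)).mul_left (orbitMass (Γ F) (qmk (a F ^ (n + 1))))
  have h1 (j : ℕ) : orbitMass (Γ F) (qmk (a F ^ (j + (n + 1)))) =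
      orbitMass (Γ F) (qmk (a F ^ (n + 1))) * (1 / (Fintype.card F : ℝ)) ^ j := by
    rw [← add_assoc, orbitMass_succ, orbitMass_succ, add_comm, pow_add, mul_assoc]
  have h2 : (Fintype.card F : ℝ) / (Fintype.card F - 1) = (1 - 1 / (Fintype.card F : ℝ))⁻¹ := by
    have : (Fintype.card F : ℝ) - 1 ≠ 0 := by linarith
    field_simp
  simp only [h1]
  rw [h2]
  exact h

theorem summable_orbitMass : Summable (orbitMass (Γ F) : QuotientVertex F → ℝ) := by
  rw [← (qEquiv F).symm.summable_iff, ← summable_nat_add_iff 1]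
  exact (hasSum_orbitMass_tail (F := F) 0).summable

theorem tsum_orbitMass_pos : 0 < ∑' x : QuotientVertex F, orbitMass (Γ F) x :=
  summable_orbitMass.tsum_pos (fun x => (orbitMass_pos x).le) (qmk 1) (orbitMass_pos _)

theorem tsum_indicator_orbitMass (n : ℕ) :
    ∑' x : QuotientVertex F, {x | n + 1 ≤ qEquiv F x}.indicator (orbitMass (Γ F)) x =
      orbitMass (Γ F) (qmk (a F ^ (n + 1))) * ((Fintype.card F : ℝ) / (Fintype.card F - 1)) := by
  rw [← (qEquiv F).symm.tsum_eq, ← (hasSum_orbitMass_tail n).tsum_eq,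
    ← (add_left_injective (n + 1)).tsum_eq]
  · refine tsum_congr fun j => ?_
    rw [Set.indicator_of_mem]
    · rfl
    · simp; omega
  · intro j hj
    have : n + 1 ≤ j := by
      by_contra h
      exact hj (Set.indicator_of_notMem (by simpa using h) _)
    exact ⟨j - (n + 1), by simp; omega⟩

theorem quotientWalk_down (n : ℕ) :
    quotientWalk F (qmk (a F ^ (n + 1))) (qmk (a F ^ n)) =
      Fintype.card F / ((Fintype.card F : ℝ) + 1) := by
  rw [quotientWalk_qmk, qlevel_qmk, level_a_pow, cnt_down (level_a_pow _)]

theorem orbitMass_mul_quotientWalk_comm (n m : ℕ) :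
    orbitMass (Γ F) (qmk (a F ^ n)) * quotientWalk F (qmk (a F ^ n)) (qmk (a F ^ m)) =
      orbitMass (Γ F) (qmk (a F ^ m)) * quotientWalk F (qmk (a F ^ m)) (qmk (a F ^ n)) := by
  have h := cnt_mul_cardStab (a F ^ n) (a F ^ m)
  have hn : (cardStab (a F ^ n) : ℝ) ≠ 0 := by exact_mod_cast (cardStab_pow_pos n).ne'
  have hm : (cardStab (a F ^ m) : ℝ) ≠ 0 := by exact_mod_cast (cardStab_pow_pos m).ne'
  rw [quotientWalk_qmk, quotientWalk_qmk, orbitMass_qmk, orbitMass_qmk, qlevel_qmk, qlevel_qmk]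
  have h' : (cnt (a F ^ n) (level (a F ^ m)) : ℝ) * cardStab (a F ^ m) =
      cnt (a F ^ m) (level (a F ^ n)) * cardStab (a F ^ n) := by exact_mod_cast h
  have hq := two_le_card (F := F)
  field_simp
  linear_combination h'

theorem quotientWalk_nonneg (x y : QuotientVertex F) : 0 ≤ quotientWalk F x y := by
  obtain ⟨g, rfl⟩ := exists_qmk x
  rw [quotientWalk_qmk]
  positivity

theorem sum_quotientWalk_le (x : QuotientVertex F) (s : Finset (QuotientVertex F)) :
    ∑ y ∈ s, quotientWalk F x y ≤ 1 := by
  obtain ⟨g, rfl⟩ := exists_qmk x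
  have hq := two_le_card (F := F)
  simp only [quotientWalk_qmk]
  rw [← Finset.sum_div, div_le_one (by linarith)]
  have h := sum_cnt_le g (s.map (qEquiv F).toEmbedding)
  rw [Finset.sum_map] at h
  exact_mod_cast h

/-- The tail from `n + 1` has mass `q/(q - 1)` times that of level `n + 1`, and the flow down to
level `n` is `q/(q + 1)` times it. The quotient is `(q - 1)/(q + 1)` for every `n`. -/
theorem le_cheegerConstant_quotientWalk : ((Fintype.card F : ℝ) - 1) / ((Fintype.card F : ℝ) + 1) ≤
    cheegerConstant (quotientMass F) (quotientWalk F) := by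
  have hq := two_le_card (F := F)
  have hZ := tsum_orbitMass_pos (F := F)
  have hs : Summable (quotientMass F) := summable_orbitMass.div_const _
  have hm (x : QuotientVertex F) : 0 < quotientMass F x := div_pos (orbitMass_pos x) hZ
  have hsym (n : ℕ) : ((Fintype.card F : ℝ) - 1) / ((Fintype.card F : ℝ) + 1) *
      ∑' x, {x | n + 1 ≤ qEquiv F x}.indicator (quotientMass F) x =
      quotientMass F ((qEquiv F).symm (n + 1)) *
        quotientWalk F ((qEquiv F).symm (n + 1)) ((qEquiv F).symm n) := by
    have h1 (x : QuotientVertex F) : {x | n + 1 ≤ qEquiv F x}.indicator (quotientMass F) x =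
        {x | n + 1 ≤ qEquiv F x}.indicator (orbitMass (Γ F)) x /
          ∑' y : QuotientVertex F, orbitMass (Γ F) y := by
      simp only [Set.indicator_apply, quotientMass]
      split_ifs <;> simp
    simp only [h1]
    rw [tsum_div_const, tsum_indicator_orbitMass, quotientMass, qEquiv_symm_apply, qEquiv_symm_apply,
      quotientWalk_down]
    have : (Fintype.card F : ℝ) - 1 ≠ 0 := by linarith
    field_simp
  refine le_cheegerConstant (qEquiv F) (by apply div_nonneg <;> linarith) hm
    quotientWalk_nonneg hs ?_ (summable_mul_of_sum_le_one (fun x => (hm x).le) hs quotientWalk_nonneg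
      sum_quotientWalk_le) (fun n => (hsym n).le)
    fun n => ((hsym n).trans ?_).le
  · exact (tsum_div_const.trans (div_self hZ.ne')).le
  · have := orbitMass_mul_quotientWalk_comm (F := F) (n + 1) n
    simp only [quotientMass, qEquiv_symm_apply]
    rw [div_mul_eq_mul_div, this, div_mul_eq_mul_div]

end RayMass

/-! ### The topology of the field of Laurent series -/

section LaurentTopology

open Filter Topology

variable {F : Type*} [Field F]

theorem mem_range_ofPowerSeries_iff {x : F⸨X⸩} :
    x ∈ Set.range (HahnSeries.ofPowerSeries ℤ F) ↔ ∀ i : ℤ, i < 0 → x.coeff i = 0 := by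
  have h := LaurentSeries.valuation_le_iff_coeff_lt_eq_zero F (D := 0) (f := x)
  rw [← h, neg_zero, WithZero.exp_zero, LaurentSeries.val_le_one_iff_eq_coe]
  rfl

theorem isOpen_range_ofPowerSeries :
    IsOpen (Set.range (HahnSeries.ofPowerSeries ℤ F) : Set F⸨X⸩) := by
  convert Valued.isOpen_integer F⸨X⸩ using 1
  ext x
  exact (LaurentSeries.val_le_one_iff_eq_coe F x).symm

theorem hasBasis_nhds_zero_laurentSeries : (𝓝 (0 : F⸨X⸩)).HasBasis (fun _ : ℕ => True)
    fun n => {x | ∀ i : ℤ, i < n → x.coeff i = 0} := by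
  refine ⟨fun s => ⟨fun h => ?_, fun ⟨n, _, hn⟩ => mem_of_superset ?_ hn⟩⟩
  · obtain ⟨γ, hγ⟩ := Valued.mem_nhds_zero.1 h
    set δ : WithZero (Multiplicative ℤ) := MonoidWithZeroHom.ValueGroup₀.embedding γ.1 with hδ
    have hδ0 : δ ≠ 0 := by simp [hδ]
    -- The exponent `N` satisfies `N ≥ 1 - log δ`, so `exp (-N) < δ` strictly.
    refine ⟨(1 - WithZero.log δ).toNat, trivial, fun x hx => hγ ?_⟩
    change Valued.v.restrict x < γ.1
    rw [Valuation.restrict_lt_iff_lt_embedding]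
    have h1 : Valued.v x ≤ WithZero.exp (-((1 - WithZero.log δ).toNat : ℤ)) :=
      (LaurentSeries.valuation_le_iff_coeff_lt_eq_zero F).2 hx
    refine h1.trans_lt ?_
    rw [← WithZero.lt_log_iff_exp_lt hδ0]
    omega
  · have hc : Continuous fun x : F⸨X⸩ => HahnSeries.single (-(n : ℤ)) (1 : F) * x :=
      continuous_const.mul continuous_id
    convert (isOpen_range_ofPowerSeries.preimage hc).mem_nhds (x := 0) ⟨0, by simp⟩ using 1
    ext x
    rw [Set.mem_preimage, mem_range_ofPowerSeries_iff]
    constructor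
    · intro h i hi
      have := HahnSeries.coeff_single_mul_add (x := x) (r := (1 : F)) (a := i + n) (b := -(n : ℤ))
      rw [add_neg_cancel_right, one_mul] at this
      rw [this]
      exact h _ (by omega)
    · intro h i hi
      have := HahnSeries.coeff_single_mul_add (x := x) (r := (1 : F)) (a := i) (b := -(n : ℤ))
      rw [one_mul] at this
      rw [← this]
      exact h _ (by omega)

/-- The power series are the image of the product of copies of the finite discrete set `F` under a
map continuous for the product topology. -/
theorem isCompact_range_ofPowerSeries [Finite F] :
    IsCompact (Set.range (HahnSeries.ofPowerSeries ℤ F) : Set F⸨X⸩) := by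
  let : TopologicalSpace F := ⊥
  have : DiscreteTopology F := ⟨rfl⟩
  let φ : (ℕ → F) → F⸨X⸩ := fun f => HahnSeries.ofPowerSeries ℤ F (PowerSeries.mk f)
  have hφ : Set.range (HahnSeries.ofPowerSeries ℤ F) = Set.range φ := by
    refine (Function.Surjective.range_comp (f := fun f : ℕ → F => PowerSeries.mk f) (fun p => ?_)
      (HahnSeries.ofPowerSeries ℤ F)).symm
    exact ⟨fun n => PowerSeries.coeff n p, by ext n; simp⟩
  rw [hφ]
  refine isCompact_range (continuous_iff_continuousAt.2 fun f => ?_)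
  rw [ContinuousAt, ← tendsto_sub_nhds_zero_iff]
  refine hasBasis_nhds_zero_laurentSeries.tendsto_right_iff.2 fun n _ => ?_
  have h1 : ∀ᶠ g in 𝓝 f, ∀ i ∈ Finset.range n, g i = f i := by
    rw [Filter.eventually_all_finset]
    intro i _
    have : Tendsto (fun g : ℕ → F => g i) (𝓝 f) (𝓝 (f i)) := (continuous_apply i).tendsto f
    rw [nhds_discrete F] at this
    exact this.eventually (p := fun y => y = f i) (by simp)
  filter_upwards [h1] with g hg i hi
  change (φ g - φ f).coeff i = 0
  rcases lt_or_ge i 0 with h0 | h0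
  · have h2 (g : ℕ → F) := mem_range_ofPowerSeries_iff.1 ⟨PowerSeries.mk g, rfl⟩ i h0
    rw [HahnSeries.coeff_sub]
    exact sub_eq_zero.2 ((h2 g).trans (h2 f).symm)
  · obtain ⟨k, rfl⟩ := Int.eq_ofNat_of_zero_le h0
    simp only [φ, HahnSeries.coeff_sub, HahnSeries.ofPowerSeries_apply_coeff, PowerSeries.coeff_mk]
    rw [hg k (by simpa using hi), sub_self]

instance [Finite F] : SecondCountableTopology F⸨X⸩ := by
  have : (𝓝 (0 : F⸨X⸩)).IsCountablyGenerated :=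
    hasBasis_nhds_zero_laurentSeries.isCountablyGenerated
  have := IsUniformAddGroup.uniformity_countably_generated (α := F⸨X⸩)
  -- The field is the union of the compact sets `tⁿ F[[t⁻¹]]`.
  have : SigmaCompactSpace F⸨X⸩ := by
    refine ⟨⟨fun n => (fun x => t F ^ n * x) '' Set.range (HahnSeries.ofPowerSeries ℤ F), fun n => ?_,
      Set.eq_univ_of_forall fun x => Set.mem_iUnion.2 ?_⟩⟩
    · exact isCompact_range_ofPowerSeries.image (continuous_const.mul continuous_id)
    · refine ⟨(-x.order).toNat, _, ⟨LaurentSeries.powerSeriesPart x *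
        PowerSeries.X ^ x.order.toNat, rfl⟩, ?_⟩
      have hX : HahnSeries.ofPowerSeries ℤ F PowerSeries.X = (t F)⁻¹ :=
        eq_inv_of_mul_eq_one_right t_mul_X
      conv_rhs => rw [eq_t_zpow_mul x]
      beta_reduce
      rw [map_mul, map_pow, hX, mul_comm (HahnSeries.ofPowerSeries ℤ F _), ← mul_assoc, ← zpow_natCast,
        inv_pow, ← zpow_natCast, ← _root_.zpow_neg, ← zpow_add₀ (t_ne_zero F)]
      congr 2
      omega
  let := UniformSpace.pseudoMetricSpace F⸨X⸩
  exact EMetric.secondCountable_of_sigmaCompact F⸨X⸩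

end LaurentTopology

/-! ### `K` is a compact open subgroup -/

section GroupTopology

variable {F : Type*} [Field F]

/-- The topology on units is induced by `g ↦ (g, g⁻¹)`, so this description through entries of `g`
and `g⁻¹` serves for both openness and compactness of `K`. -/
theorem range_map_ofPowerSeries :
    Set.range (GeneralLinearGroup.map (n := Fin 2) (HahnSeries.ofPowerSeries ℤ F)) =
      {g : GL (Fin 2) F⸨X⸩ | (∀ i j, g i j ∈ Set.range (HahnSeries.ofPowerSeries ℤ F)) ∧
        ∀ i j, (g⁻¹) i j ∈ Set.range (HahnSeries.ofPowerSeries ℤ F)} := by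
  ext g
  constructor
  · rintro ⟨k, rfl⟩
    refine ⟨fun i j => ⟨k i j, rfl⟩, fun i j => ⟨(k⁻¹) i j, ?_⟩⟩
    rw [← map_inv]
    rfl
  · rintro ⟨h1, h2⟩
    choose A hA using h1
    choose B hB using h2
    have hinj : Function.Injective
        (fun M : Matrix (Fin 2) (Fin 2) F⟦X⟧ => M.map (HahnSeries.ofPowerSeries ℤ F)) :=
      Matrix.map_injective HahnSeries.ofPowerSeries_injective
    have hAg : (Matrix.of A).map (HahnSeries.ofPowerSeries ℤ F) = g := by ext1 i j; exact hA i j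
    have hBg : (Matrix.of B).map (HahnSeries.ofPowerSeries ℤ F) = (g⁻¹ : GL (Fin 2) F⸨X⸩) := by
      ext1 i j; exact hB i j
    refine ⟨⟨Matrix.of A, Matrix.of B, hinj ?_, hinj ?_⟩, ?_⟩
    · change (Matrix.of A * Matrix.of B).map _ = (1 : Matrix _ _ _).map _
      rw [Matrix.map_mul, hAg, hBg, Matrix.map_one _ (map_zero _) (map_one _), ← Units.val_mul,
        mul_inv_cancel, Units.val_one]
    · change (Matrix.of B * Matrix.of A).map _ = (1 : Matrix _ _ _).map _
      rw [Matrix.map_mul, hAg, hBg, Matrix.map_one _ (map_zero _) (map_one _), ← Units.val_mul,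
        inv_mul_cancel, Units.val_one]
    · exact Units.ext hAg

theorem coe_K_eq_image : (K F : Set (G F)) = ProjGenLinGroup.mk ''
    Set.range (GeneralLinearGroup.map (n := Fin 2) (HahnSeries.ofPowerSeries ℤ F)) := by
  rw [← Set.range_comp]
  rfl

theorem continuous_mk : Continuous (ProjGenLinGroup.mk : GL (Fin 2) F⸨X⸩ → G F) :=
  QuotientGroup.continuous_mk

theorem isOpenMap_mk : IsOpenMap (ProjGenLinGroup.mk : GL (Fin 2) F⸨X⸩ → G F) :=
  QuotientGroup.isOpenMap_coe

theorem isOpen_K : IsOpen (K F : Set (G F)) := by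
  rw [coe_K_eq_image]
  refine isOpenMap_mk _ ?_
  rw [range_map_ofPowerSeries]
  have h1 (i j) : Continuous fun g : GL (Fin 2) F⸨X⸩ => g i j :=
    Units.continuous_val.matrix_elem i j
  have h2 : {g : GL (Fin 2) F⸨X⸩ | (∀ i j, g i j ∈ Set.range (HahnSeries.ofPowerSeries ℤ F)) ∧
        ∀ i j, (g⁻¹) i j ∈ Set.range (HahnSeries.ofPowerSeries ℤ F)} =
      (⋂ i, ⋂ j, (fun g : GL (Fin 2) F⸨X⸩ => g i j) ⁻¹' Set.range (HahnSeries.ofPowerSeries ℤ F)) ∩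
      ⋂ i, ⋂ j, (fun g : GL (Fin 2) F⸨X⸩ => (g⁻¹) i j) ⁻¹'
        Set.range (HahnSeries.ofPowerSeries ℤ F) := by
    ext g
    rw [Set.mem_inter_iff, Set.mem_iInter, Set.mem_iInter]
    exact and_congr (forall_congr' fun i => by rw [Set.mem_iInter]; rfl)
      (forall_congr' fun i => by rw [Set.mem_iInter]; rfl)
  rw [h2]
  exact (isOpen_iInter_of_finite fun i => isOpen_iInter_of_finite fun j =>
      isOpen_range_ofPowerSeries.preimage (h1 i j)).inter
    (isOpen_iInter_of_finite fun i => isOpen_iInter_of_finite fun j =>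
      isOpen_range_ofPowerSeries.preimage ((h1 i j).comp continuous_inv))

theorem isCompact_K [Finite F] : IsCompact (K F : Set (G F)) := by
  rw [coe_K_eq_image]
  refine IsCompact.image ?_ continuous_mk
  rw [range_map_ofPowerSeries]
  let S : Set (Matrix (Fin 2) (Fin 2) F⸨X⸩) :=
    Set.univ.pi fun _ => Set.univ.pi fun _ => Set.range (HahnSeries.ofPowerSeries ℤ F)
  have hS : IsCompact S :=
    isCompact_univ_pi fun _ => isCompact_univ_pi fun _ => isCompact_range_ofPowerSeries
  have hS' : IsCompact (S ×ˢ (MulOpposite.op '' S)) :=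
    hS.prod (hS.image MulOpposite.continuous_op)
  convert Units.isClosedEmbedding_embedProduct.isCompact_preimage hS' using 1
  ext g
  have hmem (M : Matrix (Fin 2) (Fin 2) F⸨X⸩) :
      (∀ i j, M i j ∈ Set.range (HahnSeries.ofPowerSeries ℤ F)) ↔ M ∈ S :=
    ⟨fun h i _ j _ => h i j, fun h i j => h i trivial j trivial⟩
  exact and_congr (hmem _) ((hmem _).trans MulOpposite.op_injective.mem_set_image.symm)

instance [Finite F] : LocallyCompactSpace (G F) :=
  isCompact_K.locallyCompactSpace_of_mem_nhds_of_group (isOpen_K.mem_nhds (one_mem _))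

instance [Finite F] : SecondCountableTopology (G F) := by
  have h1 : SecondCountableTopology (Matrix (Fin 2) (Fin 2) F⸨X⸩) :=
    inferInstanceAs (SecondCountableTopology (Fin 2 → Fin 2 → F⸨X⸩))
  have h2 : SecondCountableTopology (Matrix (Fin 2) (Fin 2) F⸨X⸩)ᵐᵒᵖ :=
    MulOpposite.opHomeomorph.symm.secondCountableTopology
  have : SecondCountableTopology (GL (Fin 2) F⸨X⸩) :=
    Units.isEmbedding_embedProduct.secondCountableTopology
  exact inferInstanceAs
    (SecondCountableTopology (GL (Fin 2) F⸨X⸩ ⧸ Subgroup.center (GL (Fin 2) F⸨X⸩)))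

end GroupTopology

/-! ### Unimodularity of `G` -/

section Unimodular

open Measure

variable {F : Type*} [Field F]

instance : MeasurableSpace (G F) := borel _

instance : BorelSpace (G F) := ⟨rfl⟩

variable [Finite F]

/-- Right translation by `k` maps `K` to itself, and `K` has positive finite Haar measure. -/
theorem modularCharacter_K {k : G F} (hk : k ∈ K F) : modularCharacter k = 1 := by
  have h := map_right_mul_eq_modularCharacterFun_smul (haar : Measure (G F)) k
  have h1 := congrArg (fun m : Measure (G F) => m (K F)) h
  have h2 : (fun x => x * k) ⁻¹' (K F : Set (G F)) = K F := by
    ext x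
    exact (K F).mul_mem_cancel_right hk
  beta_reduce at h1
  rw [map_apply (measurable_mul_const k) isOpen_K.measurableSet, h2, Measure.smul_apply] at h1
  have h3 : haar (K F : Set (G F)) ≠ 0 := (isOpen_K.measure_pos _ ⟨1, one_mem _⟩).ne'
  have h4 : haar (K F : Set (G F)) ≠ ∞ := isCompact_K.measure_ne_top
  change modularCharacterFun k = 1
  rw [ENNReal.smul_def, smul_eq_mul, eq_comm] at h1
  have h5 : (modularCharacterFun k : ℝ≥0∞) = 1 := by
    rw [← ENNReal.div_self h3 h4, ENNReal.eq_div_iff h3 h4, mul_comm, h1]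
  exact_mod_cast h5

/-- The relation `a w a = w` makes the square of the value at `a` equal to `1`; `K` and `a`
generate. -/
theorem modularCharacter_eq_one (g : G F) : modularCharacter g = 1 := by
  have ha : a F ∈ (modularCharacter : G F →* NNReal).ker := by
    have h := congrArg modularCharacter (a_w_a (F := F))
    rw [map_mul, map_mul, modularCharacter_K w_mem_K, mul_one] at h
    rw [MonoidHom.mem_ker]
    exact (pow_eq_one_iff_of_nonneg zero_le two_ne_zero).1 (by rw [sq, h])
  have := eq_top_of_le (H := (modularCharacter : G F →* NNReal).ker)
    (fun k hk => modularCharacter_K hk) ha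
  exact (this ▸ Subgroup.mem_top g : g ∈ (modularCharacter : G F →* NNReal).ker)

instance : (haar : Measure (G F)).IsMulRightInvariant where
  map_mul_right_eq_self g := by
    rw [map_right_mul_eq_modularCharacterFun_smul]
    have : modularCharacterFun g = 1 := modularCharacter_eq_one g
    rw [this, one_smul]

end Unimodular

/-! ### Invariant measures on a coset space from weights on the group -/

section QuotientMeasure

variable {G : Type*} [Group G] {Λ : Subgroup G}

theorem CosetSpace.continuous_mk [TopologicalSpace G] : Continuous (CosetSpace.mk Λ) := continuous_quotient_mk'

theorem CosetSpace.mk_mul_left (γ : Λ) (g : G) : CosetSpace.mk Λ (γ * g) = CosetSpace.mk Λ g :=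
  (Quotient.sound ⟨γ, rfl⟩ : (Quotient.mk (QuotientGroup.rightRel Λ) _ : CosetSpace Λ) = _)

variable [TopologicalSpace G] [IsTopologicalGroup G] [MeasurableSpace G] [BorelSpace G]
  [Countable Λ] {μ : Measure G} [μ.IsMulLeftInvariant]

/-- Unfolding: insert `∑ w' (γ g) = 1`, translate each term by `γ`, and sum `w` instead. The measure
pushed to the quotient does not depend on the weight. -/
theorem lintegral_mul_comp_mk_congr {w w' : G → ℝ≥0∞} (hw : Measurable w) (hw' : Measurable w')
    (hw1 : ∀ g, ∑' γ : Λ, w (γ * g) = 1) (hw1' : ∀ g, ∑' γ : Λ, w' (γ * g) = 1)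
    {h : CosetSpace Λ → ℝ≥0∞} (hh : Measurable h) :
    ∫⁻ g, w g * h (CosetSpace.mk Λ g) ∂μ = ∫⁻ g, w' g * h (CosetSpace.mk Λ g) ∂μ := by
  have hπ : Measurable fun g => h (CosetSpace.mk Λ g) :=
    hh.comp CosetSpace.continuous_mk.measurable
  calc ∫⁻ g, w g * h (CosetSpace.mk Λ g) ∂μ
      = ∫⁻ g, ∑' γ : Λ, w' (γ * g) * (w g * h (CosetSpace.mk Λ g)) ∂μ := by
        refine lintegral_congr fun g => ?_
        rw [ENNReal.tsum_mul_right, hw1', one_mul]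
    _ = ∑' γ : Λ, ∫⁻ g, w' (γ * g) * (w g * h (CosetSpace.mk Λ g)) ∂μ :=
        lintegral_tsum fun γ => ((hw'.comp (measurable_const_mul _)).mul (hw.mul hπ)).aemeasurable
    _ = ∑' γ : Λ, ∫⁻ g, w (((γ⁻¹ : Λ) : G) * g) * (w' g * h (CosetSpace.mk Λ g)) ∂μ := by
        refine tsum_congr fun γ => ?_
        rw [← lintegral_mul_left_eq_self
          (fun g => w (((γ⁻¹ : Λ) : G) * g) * (w' g * h (CosetSpace.mk Λ g))) (γ : G)]
        refine lintegral_congr fun g => ?_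
        rw [CosetSpace.mk_mul_left, Subgroup.coe_inv, inv_mul_cancel_left]
        ring
    _ = ∫⁻ g, ∑' γ : Λ, w (((γ⁻¹ : Λ) : G) * g) * (w' g * h (CosetSpace.mk Λ g)) ∂μ :=
        (lintegral_tsum fun γ =>
          ((hw.comp (measurable_const_mul _)).mul (hw'.mul hπ)).aemeasurable).symm
    _ = ∫⁻ g, w' g * h (CosetSpace.mk Λ g) ∂μ := by
        refine lintegral_congr fun g => ?_
        have h1 := (Equiv.inv Λ).tsum_eq (fun γ : Λ => w (γ * g))
        simp only [Equiv.inv_apply] at h1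
        rw [ENNReal.tsum_mul_right, h1, hw1, one_mul]

/-- Translating by `c` replaces `w` by `g ↦ w (g c)`, again a weight with sum `1` along each coset.
-/
theorem smulInvariantMeasure_map_withDensity [μ.IsMulRightInvariant] {w : G → ℝ≥0∞}
    (hw : Measurable w) (hw1 : ∀ g, ∑' γ : Λ, w (γ * g) = 1) :
    SMulInvariantMeasure G (CosetSpace Λ) ((μ.withDensity w).map (CosetSpace.mk Λ)) where
  measure_preimage_smul c s hs := by
    have key {u : Set (CosetSpace Λ)} (hu : MeasurableSet u) :
        (μ.withDensity w).map (CosetSpace.mk Λ) u =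
          ∫⁻ g, w g * u.indicator 1 (CosetSpace.mk Λ g) ∂μ := by
      have hu' := CosetSpace.continuous_mk.measurable hu
      rw [Measure.map_apply CosetSpace.continuous_mk.measurable hu, withDensity_apply _ hu',
        ← lintegral_indicator hu']
      refine lintegral_congr fun g => ?_
      by_cases hg : CosetSpace.mk Λ g ∈ u
      · rw [Set.indicator_of_mem hg, Set.indicator_of_mem (by exact hg), Pi.one_apply, mul_one]
      · rw [Set.indicator_of_notMem hg, Set.indicator_of_notMem (by exact hg), mul_zero]
    rw [key hs, key (measurable_const_smul c hs), ← lintegral_mul_right_eq_self _ c]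
    have hw' : Measurable fun g => w (g * c) := hw.comp (measurable_mul_const c)
    rw [lintegral_mul_comp_mk_congr hw hw' hw1 (fun g => by simpa [mul_assoc] using hw1 (g * c))
      ((measurable_one.indicator hs))]
    refine lintegral_congr fun g => ?_
    have : c • CosetSpace.mk Λ (g * c) = CosetSpace.mk Λ g := by
      rw [CosetSpace.smul_mk, mul_inv_cancel_right]
    have hiff : CosetSpace.mk Λ (g * c) ∈ (fun x => c • x) ⁻¹' s ↔ CosetSpace.mk Λ g ∈ s := by
      rw [Set.mem_preimage, this]
    by_cases hg : CosetSpace.mk Λ g ∈ s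
    · rw [Set.indicator_of_mem hg, Set.indicator_of_mem (hiff.2 hg), Pi.one_apply, Pi.one_apply]
    · rw [Set.indicator_of_notMem hg, Set.indicator_of_notMem (mt hiff.1 hg)]

end QuotientMeasure

/-! ### The invariant probability measure -/

section Existence

open Measure

variable {F : Type*} [Field F]

instance [Finite F] : Countable (Γ F) := by
  have h0 : Countable F[X] := by
    have := Cardinal.mk_le_aleph0_iff.1 (Polynomial.cardinalMk_le_max (R := F) |>.trans (by simp))
    exact this
  have h2 : Countable (Matrix (Fin 2) (Fin 2) F[X]) :=
    inferInstanceAs (Countable (Fin 2 → Fin 2 → F[X]))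
  have h1 : Countable (GL (Fin 2) F[X]) := Function.Injective.countable Units.val_injective
  exact (Set.countable_range (ofPoly F)).to_subtype

/-- A weight on `G` whose sum over every coset `Γ g` is one. -/
def weight (g : G F) : ℝ≥0∞ := by
  classical
  exact if (g : Vertex F) = ((a F ^ level g : G F) : Vertex F) then
    (cardStab (a F ^ level g) : ℝ≥0∞)⁻¹ else 0

theorem weight_mul_right {g k : G F} (hk : k ∈ K F) : weight (g * k) = weight g := by
  rw [weight, weight, level_mul_right hk, QuotientGroup.mk_mul_of_mem _ hk]

theorem measurable_weight : Measurable (weight (F := F)) := by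
  have : IsLocallyConstant (weight (F := F)) := by
    refine (IsLocallyConstant.iff_eventually_eq _).2 fun g => ?_
    have h : Filter.Tendsto (fun x => g⁻¹ * x) (nhds g) (nhds 1) := by
      simpa using (continuous_const_mul g⁻¹).tendsto g
    filter_upwards [h (isOpen_K.mem_nhds (one_mem (K F)))] with x hx
    rw [← weight_mul_right (g := g) hx, mul_inv_cancel_left]
  exact this.continuous.measurable

variable [Fintype F]

/-- The `γ` for which `γ g` lands on the vertex `aⁿ K` form a coset of its stabilizer, and each
contributes the inverse of the order of that stabilizer. -/
theorem tsum_weight (g : G F) : ∑' γ : Γ F, weight ((γ : G F) * g) = 1 := by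
  classical
  obtain ⟨γ₀, hγ₀, k, hk, hg⟩ := inLevel_level g
  set n := level g
  have hpos := cardStab_pow_pos (F := F) n
  have : Finite (MulAction.stabilizer (Γ F) ((a F ^ n : G F) : Vertex F)) :=
    Nat.finite_of_card_ne_zero hpos.ne'
  have h1 (γ : Γ F) : weight (((γ * ⟨γ₀, hγ₀⟩⁻¹ : Γ F) : G F) * g) =
      (MulAction.stabilizer (Γ F) ((a F ^ n : G F) : Vertex F) : Set (Γ F)).indicator
        (fun _ => (cardStab (a F ^ n) : ℝ≥0∞)⁻¹) γ := by
    have h2 : ((γ * ⟨γ₀, hγ₀⟩⁻¹ : Γ F) : G F) * g = γ * a F ^ n * k := by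
      rw [hg]
      simp only [Subgroup.coe_mul, Subgroup.coe_inv]
      group
    rw [h2, weight_mul_right hk, weight, level_mul_left γ.2, level_a_pow, Set.indicator_apply]
    exact if_congr Iff.rfl rfl rfl
  rw [← (Equiv.mulRight (⟨γ₀, hγ₀⟩⁻¹ : Γ F)).tsum_eq]
  simp only [Equiv.coe_mulRight, h1]
  rw [← tsum_subtype, ENNReal.tsum_const]
  have h3 : (ENat.card (MulAction.stabilizer (Γ F) ((a F ^ n : G F) : Vertex F)) : ℝ≥0∞) =
      (cardStab (a F ^ n) : ℝ≥0∞) := by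
    rw [ENat.card_eq_coe_natCard]
    rfl
  refine Eq.trans ?_ (ENNReal.mul_inv_cancel (a := (cardStab (a F ^ n) : ℝ≥0∞)) ?_ ?_)
  · exact congrArg₂ _ h3 rfl
  · exact_mod_cast hpos.ne'
  · simp

theorem lintegral_weight_ne_zero : ∫⁻ g, weight g ∂(haar : Measure (G F)) ≠ 0 := by
  intro h0
  rw [lintegral_eq_zero_iff measurable_weight] at h0
  have h1 : haar (K F : Set (G F)) = 0 := by
    refine measure_mono_null (fun k hk => ?_) h0
    have h2 : level k = 0 := by
      have := level_mul_right hk (a F ^ 0)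
      rwa [level_a_pow, pow_zero, one_mul] at this
    change weight k ≠ 0
    rw [weight, if_pos]
    · simp
    · rw [h2, pow_zero, eq_comm, QuotientGroup.eq]
      simpa using hk
  exact (isOpen_K.measure_pos haar ⟨1, one_mem _⟩).ne' h1

/-- The weight lives on the cosets `aⁿ K`, all of Haar measure that of `K`, so its integral is at
most the Haar measure of `K` times the sum of the orbit masses. -/
theorem lintegral_weight_ne_top : ∫⁻ g, weight g ∂(haar : Measure (G F)) ≠ ∞ := by
  have hmeas (n : ℕ) : MeasurableSet ((fun g => (a F ^ n)⁻¹ * g) ⁻¹' (K F : Set (G F))) :=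
    measurable_const_mul _ isOpen_K.measurableSet
  have h1 (g : G F) : weight g ≤ ∑' n, ((fun g => (a F ^ n)⁻¹ * g) ⁻¹' (K F : Set (G F))).indicator
      (fun _ => ENNReal.ofReal (orbitMass (Γ F) (qmk (a F ^ n)))) g := by
    rw [weight]
    split_ifs with h
    · refine le_trans (le_of_eq ?_) (ENNReal.le_tsum (level g))
      rw [Set.indicator_of_mem, orbitMass_qmk, one_div, ENNReal.ofReal_inv_of_pos,
        ENNReal.ofReal_natCast]
      · exact_mod_cast cardStab_pow_pos _
      · exact QuotientGroup.eq.1 h.symm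
    · exact zero_le
  refine ne_top_of_le_ne_top ?_ (lintegral_mono h1)
  rw [lintegral_tsum fun n => (measurable_const.indicator (hmeas n)).aemeasurable]
  have h2 (n : ℕ) : ∫⁻ g, ((fun g => (a F ^ n)⁻¹ * g) ⁻¹' (K F : Set (G F))).indicator
      (fun _ => ENNReal.ofReal (orbitMass (Γ F) (qmk (a F ^ n)))) g ∂haar =
      ENNReal.ofReal (orbitMass (Γ F) (qmk (a F ^ n))) * haar (K F : Set (G F)) := by
    rw [lintegral_indicator_const (hmeas n), measure_preimage_mul]
  simp only [h2]
  rw [ENNReal.tsum_mul_right]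
  refine ENNReal.mul_ne_top ?_ isCompact_K.measure_ne_top
  have h3 : Summable fun n => orbitMass (Γ F) (qmk (a F ^ n)) :=
    (qEquiv F).symm.summable_iff.2 summable_orbitMass
  rw [← ENNReal.ofReal_tsum_of_nonneg (fun n => (orbitMass_pos _).le) h3]
  exact ENNReal.ofReal_ne_top

theorem exists_invariant_probability : ∃ m : Measure (CosetSpace (Γ F)),
    IsProbabilityMeasure m ∧ SMulInvariantMeasure (G F) (CosetSpace (Γ F)) m := by
  set ν := ((haar : Measure (G F)).withDensity weight).map (CosetSpace.mk (Γ F))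
  have hν : SMulInvariantMeasure (G F) (CosetSpace (Γ F)) ν :=
    smulInvariantMeasure_map_withDensity measurable_weight tsum_weight
  have huniv : ν Set.univ = ∫⁻ g, weight g ∂(haar : Measure (G F)) := by
    rw [Measure.map_apply CosetSpace.continuous_mk.measurable MeasurableSet.univ, Set.preimage_univ,
      withDensity_apply _ MeasurableSet.univ, Measure.restrict_univ]
  refine ⟨(ν Set.univ)⁻¹ • ν, ⟨?_⟩, inferInstance⟩
  rw [Measure.smul_apply, smul_eq_mul, huniv]
  exact ENNReal.inv_mul_cancel lintegral_weight_ne_zero lintegral_weight_ne_top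

end Existence

/-! ### Continuity of the action on the coset space -/

section Action

variable {G : Type*} [Group G] [TopologicalSpace G] [IsTopologicalGroup G] {Λ : Subgroup G}

theorem CosetSpace.isOpenQuotientMap_mk : IsOpenQuotientMap (CosetSpace.mk Λ) :=
  MulAction.isOpenQuotientMap_quotientMk (Γ := Λ) (T := G)

theorem CosetSpace.continuousSMul : ContinuousSMul G (CosetSpace Λ) where
  continuous_smul := by
    have h := (IsOpenQuotientMap.id (X := G)).prodMap (CosetSpace.isOpenQuotientMap_mk (Λ := Λ))
    refine h.continuous_comp_iff.1 ?_
    change Continuous fun p : G × G => CosetSpace.mk Λ (p.2 * p.1⁻¹)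
    exact CosetSpace.continuous_mk.comp (continuous_snd.mul continuous_fst.inv)

end Action

/-! ### The level on `Γ \ G` -/

section Levels

variable {F : Type*} [Field F]

/-- The level of a point of `Γ \ G`. -/
def ylevel : CosetSpace (Γ F) → ℕ :=
  Quotient.lift level (by
    rintro x y ⟨γ, rfl⟩
    exact level_mul_left γ.2 y)

theorem ylevel_mk (g : G F) : ylevel (CosetSpace.mk (Γ F) g) = level g := rfl

theorem CosetSpace.exists_mk (y : CosetSpace (Γ F)) : ∃ g, CosetSpace.mk (Γ F) g = y :=
  Quotient.exists_rep y

theorem ylevel_smul {k : G F} (hk : k ∈ K F) (y : CosetSpace (Γ F)) : ylevel (k • y) = ylevel y := by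
  obtain ⟨g, rfl⟩ := CosetSpace.exists_mk y
  rw [CosetSpace.smul_mk, ylevel_mk, ylevel_mk, level_mul_right (inv_mem hk)]

/-- Each level set is a single `K`-orbit; this is why `K`-invariant functions depend only on the
level. -/
theorem exists_smul_of_ylevel_eq {y z : CosetSpace (Γ F)} (h : ylevel y = ylevel z) :
    ∃ k ∈ K F, z = k • y := by
  obtain ⟨g, rfl⟩ := CosetSpace.exists_mk y
  obtain ⟨g', rfl⟩ := CosetSpace.exists_mk z
  obtain ⟨γ, hγ, k, hk, rfl⟩ := exists_of_level_eq h
  refine ⟨k⁻¹, inv_mem hk, ?_⟩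
  rw [CosetSpace.smul_mk, inv_inv, mul_assoc]
  exact CosetSpace.mk_mul_left ⟨γ, hγ⟩ _

theorem measurable_ylevel : Measurable (ylevel (F := F)) := by
  have : IsLocallyConstant (level (F := F)) := by
    refine (IsLocallyConstant.iff_eventually_eq _).2 fun g => ?_
    have h : Filter.Tendsto (fun x => g⁻¹ * x) (nhds g) (nhds 1) := by
      simpa using (continuous_const_mul g⁻¹).tendsto g
    filter_upwards [h (isOpen_K.mem_nhds (one_mem (K F)))] with x hx
    rw [← level_mul_right hx g, mul_inv_cancel_left]
  have hc : Continuous (ylevel (F := F)) := this.continuous.quotient_lift _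
  exact hc.measurable

theorem exists_ylevel_kap {n : ℕ} {y : CosetSpace (Γ F)} (h : ylevel y = n + 1) :
    ∃ i₀ : Option F, ylevel ((a F)⁻¹ • (kap i₀)⁻¹ • y) = n + 2 ∧
      ∀ i ≠ i₀, ylevel ((a F)⁻¹ • (kap i)⁻¹ • y) = n := by
  obtain ⟨g, rfl⟩ := CosetSpace.exists_mk y
  simp only [CosetSpace.smul_mk, ylevel_mk, inv_inv]
  exact exists_level_kap h

theorem ylevel_of_succ {n : ℕ} {y : CosetSpace (Γ F)} (h : ylevel y = n + 1) :
    ylevel ((a F)⁻¹ • y) = n + 2 ∨ ylevel ((a F)⁻¹ • y) = n := by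
  obtain ⟨i₀, h1, h2⟩ := exists_ylevel_kap h
  by_cases hi : none = i₀
  · subst hi
    left
    simpa [kap_none] using h1
  · right
    simpa [kap_none] using h2 none hi

end Levels

/-! ### Level masses of an arbitrary invariant measure -/

section Flow

variable {F : Type*} [Field F] (m : Measure (CosetSpace (Γ F)))

/-- The mass of the points of level `n`. -/
def levelMass (n : ℕ) : ℝ≥0∞ := m {y | ylevel y = n}

/-- The mass of the points moved by `a⁻¹` from level `n` to level `n + 1`. -/
def upMass (n : ℕ) : ℝ≥0∞ := m {y | ylevel y = n ∧ ylevel ((a F)⁻¹ • y) = n + 1}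

theorem measurable_ylevel_smul (g : G F) :
    Measurable fun y : CosetSpace (Γ F) => ylevel (g • y) :=
  measurable_ylevel.comp (measurable_const_smul g)

theorem measurableSet_jump (g : G F) (i j : ℕ) :
    MeasurableSet {y : CosetSpace (Γ F) | ylevel y = i ∧ ylevel (g • y) = j} :=
  (measurable_ylevel (measurableSet_singleton i)).inter
    (measurable_ylevel_smul g (measurableSet_singleton j))

variable [SMulInvariantMeasure (G F) (CosetSpace (Γ F)) m]

/-- Translation by `a w` preserves `m` and exchanges the two kinds of jump, because `a⁻¹ = w a w`
and `w` does not change the level. -/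
theorem downMass_eq_upMass (n : ℕ) :
    m {y | ylevel y = n + 1 ∧ ylevel ((a F)⁻¹ • y) = n} = upMass m n := by
  rw [upMass, ← measure_preimage_smul m (a F * w F)
    {y | ylevel y = n ∧ ylevel ((a F)⁻¹ • y) = n + 1}]
  refine congrArg m (Set.ext fun y => ?_)
  have h1 : ylevel ((a F)⁻¹ • y) = ylevel ((a F * w F) • y) := by
    rw [a_inv, mul_assoc, mul_smul, ylevel_smul w_mem_K]
  have h2 : ylevel ((a F)⁻¹ • (a F * w F) • y) = ylevel y := by
    rw [mul_smul, inv_smul_smul, ylevel_smul w_mem_K]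
  change (ylevel y = n + 1 ∧ ylevel ((a F)⁻¹ • y) = n) ↔
    ylevel ((a F * w F) • y) = n ∧ ylevel ((a F)⁻¹ • (a F * w F) • y) = n + 1
  rw [h1, h2, and_comm]

variable [Fintype F]

/-- A point of level `n + 1` has exactly one upward direction, so the level set is partitioned into
the `q + 1` translates by `kap i` of the points moved up by `a⁻¹`. -/
theorem levelMass_succ (n : ℕ) :
    levelMass m (n + 1) = ((Fintype.card F : ℝ≥0∞) + 1) * upMass m (n + 1) := by
  classical
  set E : Set (CosetSpace (Γ F)) := {y | ylevel y = n + 1 ∧ ylevel ((a F)⁻¹ • y) = n + 1 + 1}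
  have hE : MeasurableSet E := measurableSet_jump _ _ _
  have hcard : ((Fintype.card F : ℝ≥0∞) + 1) = ((Finset.univ : Finset (Option F)).card : ℝ≥0∞) := by
    rw [Finset.card_univ, Fintype.card_option]
    push_cast
    rfl
  have hsum : ((Fintype.card F : ℝ≥0∞) + 1) * upMass m (n + 1) =
      ∑ i : Option F, m ((fun y => (kap i)⁻¹ • y) ⁻¹' E) := by
    rw [Finset.sum_congr rfl fun i _ => measure_preimage_smul m (kap i)⁻¹ E, Finset.sum_const,
      nsmul_eq_mul, hcard]
    rfl
  rw [hsum, ← measure_biUnion_finset]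
  · refine congrArg m (Set.ext fun y => ?_)
    simp only [Set.mem_iUnion, Finset.mem_univ, exists_prop, true_and]
    constructor
    · intro h
      obtain ⟨i₀, h1, -⟩ := exists_ylevel_kap h
      exact ⟨i₀, (ylevel_smul (inv_mem (kap_mem i₀)) y).trans h, h1⟩
    · rintro ⟨i, h1, -⟩
      exact (ylevel_smul (inv_mem (kap_mem i)) y).symm.trans h1
  · intro i _ j _ hij
    refine Set.disjoint_left.2 fun y hi hj => hij ?_
    obtain ⟨i₀, -, h2⟩ := exists_ylevel_kap ((ylevel_smul (inv_mem (kap_mem i)) y).symm.trans hi.1)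
    have hi' : i = i₀ := by
      by_contra h
      have h3 := h2 i h
      have h4 : ylevel ((a F)⁻¹ • (kap i)⁻¹ • y) = n + 1 + 1 := hi.2
      omega
    have hj' : j = i₀ := by
      by_contra h
      have h3 := h2 j h
      have h4 : ylevel ((a F)⁻¹ • (kap j)⁻¹ • y) = n + 1 + 1 := hj.2
      omega
    rw [hi', hj']
  · exact fun i _ => measurable_const_smul _ hE

/-- Level `n + 1` splits into points moved down and points moved up, of masses `upMass m n` and
`upMass m (n + 1)`; compare with `levelMass_succ` and cancel, which needs finite mass. -/
theorem upMass_eq_mul [IsFiniteMeasure m] (n : ℕ) :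
    upMass m n = (Fintype.card F : ℝ≥0∞) * upMass m (n + 1) := by
  have h1 : levelMass m (n + 1) = upMass m n + upMass m (n + 1) := by
    rw [← downMass_eq_upMass, upMass, ← measure_union _ (measurableSet_jump _ _ _)]
    · refine congrArg m (Set.ext fun y => ?_)
      constructor
      · intro h
        rcases ylevel_of_succ h with h' | h'
        · exact .inr ⟨h, h'⟩
        · exact .inl ⟨h, h'⟩
      · rintro (h | h) <;> exact h.1
    · refine Set.disjoint_left.2 fun y hi hj => ?_
      have h3 := hi.2
      have h4 := hj.2
      omega
  rw [levelMass_succ, add_mul, one_mul] at h1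
  exact ((ENNReal.add_left_inj (measure_ne_top _ _)).1 h1).symm

end Flow

/-! ### A Hardy inequality along the ray -/

section Hardy

/-- A discrete Hardy inequality for a geometric weight. -/
theorem hardy_geometric {q : ℝ≥0∞} (hq : 2 ≤ q) {e x δ : ℕ → ℝ≥0∞} (he : ∀ n, e n = q * e (n + 1))
    (hx0 : x 0 = 0) (hx : ∀ n, 2 * x (n + 1) ≤ 3 * x n + 6 * δ n) (hfin : ∑' n, e n * x n ≠ ∞) :
    ∑' n, e n * x n ≤ 6 * ∑' n, e n * δ n := by
  set S := ∑' n, e n * x n with hS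
  -- Shifting the index loses nothing because `x 0 = 0`.
  have h1 : q * S = ∑' n, e n * x (n + 1) := by
    rw [hS, _root_.tsum_eq_zero_add' ENNReal.summable, hx0, mul_zero, zero_add, ← ENNReal.tsum_mul_left]
    exact tsum_congr fun n => by rw [he n, mul_assoc]
  -- Since `q ≥ 2`, `4S ≤ 2qS`, which beats the `3S` coming from the recursion; finiteness of `S`
  -- allows the cancellation.
  have h2 : S + 3 * S ≤ 6 * (∑' n, e n * δ n) + 3 * S := by
    calc S + 3 * S = 2 * (2 * S) := by ring
      _ ≤ 2 * (q * S) := by gcongr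
      _ = ∑' n, e n * (2 * x (n + 1)) := by
        rw [h1, ← ENNReal.tsum_mul_left]
        exact tsum_congr fun n => by ring
      _ ≤ ∑' n, (6 * (e n * δ n) + 3 * (e n * x n)) := by
        refine ENNReal.tsum_le_tsum fun n => (mul_le_mul_right (hx n) _).trans (le_of_eq ?_)
        ring
      _ = 6 * (∑' n, e n * δ n) + 3 * S := by
        rw [ENNReal.tsum_add, ENNReal.tsum_mul_left, ENNReal.tsum_mul_left]
  exact ENNReal.le_of_add_le_add_right (ENNReal.mul_ne_top (by simp) hfin) h2

/-- The slack is at least `(‖b‖ - 2‖c‖)²`. The constants are chosen so that the coefficient `3/2` of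
`‖b‖²` stays below `2 ≤ q`. -/
theorem two_mul_enorm_sq_le (b c : ℂ) : 2 * ‖b + c‖ₑ ^ 2 ≤ 3 * ‖b‖ₑ ^ 2 + 6 * ‖c‖ₑ ^ 2 := by
  have h : 2 * ‖b + c‖ ^ 2 ≤ 3 * ‖b‖ ^ 2 + 6 * ‖c‖ ^ 2 := by
    have h1 := norm_add_le b c
    have h2 : ‖b + c‖ ^ 2 ≤ (‖b‖ + ‖c‖) ^ 2 := by gcongr
    nlinarith [sq_nonneg (‖b‖ - 2 * ‖c‖), sq_nonneg ‖c‖]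
  have h' : 2 * ‖b + c‖₊ ^ 2 ≤ 3 * ‖b‖₊ ^ 2 + 6 * ‖c‖₊ ^ 2 := h
  simp only [enorm_eq_nnnorm]
  exact_mod_cast h'

variable {F : Type*} [Field F] (m : Measure (CosetSpace (Γ F)))

theorem lintegral_comp_ylevel (u : ℕ → ℝ≥0∞) :
    ∫⁻ y, u (ylevel y) ∂m = ∑' n, levelMass m n * u n := by
  rw [← lintegral_map (f := u) (measurable_of_countable u) measurable_ylevel, lintegral_countable']
  refine tsum_congr fun n => ?_
  rw [Measure.map_apply measurable_ylevel (measurableSet_singleton n), mul_comm]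
  rfl

theorem tsum_upMass_mul_le (v : ℕ × ℕ → ℝ≥0∞) :
    ∑' n, upMass m n * v (n, n + 1) ≤ ∫⁻ y, v (ylevel y, ylevel ((a F)⁻¹ • y)) ∂m := by
  have hm : Measurable fun y : CosetSpace (Γ F) => (ylevel y, ylevel ((a F)⁻¹ • y)) :=
    measurable_ylevel.prodMk (measurable_ylevel_smul _)
  rw [← lintegral_map (f := v) (measurable_of_countable v) hm, lintegral_countable']
  have hinj : Function.Injective fun n : ℕ => (n, n + 1) := fun i j h => congrArg Prod.fst h
  refine le_trans (le_of_eq (tsum_congr fun n => ?_)) (ENNReal.tsum_comp_le_tsum_of_injective hinj _)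
  rw [Measure.map_apply hm (measurableSet_singleton _), mul_comm]
  refine congrArg (v (n, n + 1) * ·) (congrArg m (Set.ext fun y => ?_))
  exact (Prod.mk_inj (a₁ := ylevel y)).symm

variable [Fintype F] [SMulInvariantMeasure (G F) (CosetSpace (Γ F)) m] [IsFiniteMeasure m]

/-- The Poincaré inequality for functions of the level. -/
theorem lintegral_enorm_sub_sq_le (ψ : ℕ → ℂ)
    (hfin : ∫⁻ y, ‖ψ (ylevel y) - ψ 0‖ₑ ^ 2 ∂m ≠ ∞) :
    ∫⁻ y, ‖ψ (ylevel y) - ψ 0‖ₑ ^ 2 ∂m ≤ 6 * ((Fintype.card F : ℝ≥0∞) + 1) *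
      ∫⁻ y, ‖ψ (ylevel ((a F)⁻¹ • y)) - ψ (ylevel y)‖ₑ ^ 2 ∂m := by
  set q : ℝ≥0∞ := (Fintype.card F : ℝ≥0∞)
  have hq : 2 ≤ q := by
    have h : 2 ≤ Fintype.card F := Fintype.one_lt_card
    simpa [q] using (Nat.cast_le (α := ℝ≥0∞)).2 h
  set x : ℕ → ℝ≥0∞ := fun n => ‖ψ n - ψ 0‖ₑ ^ 2 with hx
  have hx0 : x 0 = 0 := by simp [hx]
  -- Level `0` contributes nothing, so `levelMass_succ` applies to every remaining term.
  have hL : ∫⁻ y, ‖ψ (ylevel y) - ψ 0‖ₑ ^ 2 ∂m = (q + 1) * ∑' n, upMass m n * x n := by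
    rw [lintegral_comp_ylevel m x, (_root_.tsum_eq_zero_add' ENNReal.summable :
        ∑' n, levelMass m n * x n = _), hx0, mul_zero, zero_add,
      (_root_.tsum_eq_zero_add' ENNReal.summable : ∑' n, upMass m n * x n = _), hx0, mul_zero, zero_add,
      ← ENNReal.tsum_mul_left]
    exact tsum_congr fun n => by rw [levelMass_succ, mul_assoc]
  rw [hL] at hfin ⊢
  have hS : ∑' n, upMass m n * x n ≠ ∞ := fun h => hfin (by
    rw [h, ENNReal.mul_top (by simp)])
  have hH := hardy_geometric hq (e := upMass m) (x := x) (δ := fun n => ‖ψ (n + 1) - ψ n‖ₑ ^ 2)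
    (upMass_eq_mul m) hx0 (fun n => by
      have := two_mul_enorm_sq_le (ψ n - ψ 0) (ψ (n + 1) - ψ n)
      rwa [show ψ n - ψ 0 + (ψ (n + 1) - ψ n) = ψ (n + 1) - ψ 0 by ring] at this) hS
  have hD := tsum_upMass_mul_le m fun p => ‖ψ p.2 - ψ p.1‖ₑ ^ 2
  calc (q + 1) * ∑' n, upMass m n * x n
      ≤ (q + 1) * (6 * ∫⁻ y, ‖ψ (ylevel ((a F)⁻¹ • y)) - ψ (ylevel y)‖ₑ ^ 2 ∂m) := by
        gcongr
        exact hH.trans (by gcongr)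
    _ = _ := by ring

end Hardy

/-! ### Almost fixed vectors are close to fixed vectors -/

section FixedVector

variable {H ι : Type*} [NormedAddCommGroup H] [InnerProductSpace ℂ H] [CompleteSpace H]

/-- A vector of a closed invariant subspace that is moved by at most `δ` by a semigroup of
isometries is at distance at most `δ` from a fixed vector of the subspace. -/
theorem exists_fixed_of_norm_sub_le [Nonempty ι] (ρ : ι → H →ₗᵢ[ℂ] H)
    (hρ : ∀ i j, ∃ k, ∀ x, ρ i (ρ j x) = ρ k x) (W : Submodule ℂ H) (hW : IsClosed (W : Set H))
    {f : H} {δ : ℝ} (hfW : ∀ i, ρ i f ∈ W) (hδ : ∀ i, ‖ρ i f - f‖ ≤ δ) :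
    ∃ v ∈ W, (∀ i, ρ i v = v) ∧ ‖v - f‖ ≤ δ := by
  let _ := InnerProductSpace.rclikeToReal ℂ H
  set C : Set H := closure (convexHull ℝ (Set.range fun i => ρ i f)) with hC
  have hCc : Convex ℝ C := (convex_convexHull ℝ _).closure
  have hCsub : ∀ T : Set H, Convex ℝ T → IsClosed T → (∀ i, ρ i f ∈ T) → C ⊆ T :=
    fun T h1 h2 h3 => closure_minimal (convexHull_min (Set.range_subset_iff.2 h3) h1) h2
  have hmem : ∀ i, ρ i f ∈ C := fun i => subset_closure (subset_convexHull ℝ _ ⟨i, rfl⟩)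
  have hCW : C ⊆ W := hCsub W
    (fun x hx y hy s t _ _ _ => W.add_mem (W.smul_mem (s : ℂ) hx) (W.smul_mem (t : ℂ) hy)) hW hfW
  have hCB : C ⊆ Metric.closedBall f δ := hCsub _ (convex_closedBall f δ)
    Metric.isClosed_closedBall (fun i => by simpa [dist_eq_norm] using hδ i)
  have hCρ : ∀ i, ∀ x ∈ C, ρ i x ∈ C := fun i => hCsub (ρ i ⁻¹' C)
    (fun x hx y hy s t hs ht hst => by
      have h : ρ i (s • x + t • y) = s • ρ i x + t • ρ i y := by
        rw [map_add]
        exact congrArg₂ (· + ·) ((ρ i).map_smul (s : ℂ) x) ((ρ i).map_smul (t : ℂ) y)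
      rw [Set.mem_preimage, h]
      exact hCc hx hy hs ht hst)
    (isClosed_closure.preimage (ρ i).continuous)
    (fun j => by
      obtain ⟨k, hk⟩ := hρ i j
      rw [Set.mem_preimage, hk]
      exact hmem k)
  -- The fixed vector is the element of least norm in the closed convex hull of the orbit.
  -- Minimality gives `⟪v, ρ i v - v⟫ ≥ 0`, and with `‖ρ i v‖ = ‖v‖` this forces `ρ i v = v`.
  obtain ⟨v, hv, hmin⟩ := exists_norm_eq_iInf_of_complete_convex
    ⟨_, hmem (Classical.arbitrary ι)⟩ isClosed_closure.isComplete hCc 0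
  rw [norm_eq_iInf_iff_real_inner_le_zero hCc hv] at hmin
  refine ⟨v, hCW hv, fun i => ?_, by simpa [dist_eq_norm] using hCB hv⟩
  have h1 := hmin _ (hCρ i v hv)
  have h2 := norm_add_sq_real v (ρ i v - v)
  rw [add_sub_cancel, (ρ i).norm_map] at h2
  rw [zero_sub, inner_neg_left] at h1
  have h3 : ‖ρ i v - v‖ ^ 2 ≤ 0 := by linarith
  rw [← sub_eq_zero, ← norm_eq_zero]
  exact pow_eq_zero_iff two_ne_zero |>.1 (le_antisymm h3 (sq_nonneg _))

end FixedVector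

/-! ### The Koopman representation and norms in `L²` -/

section Koopman

variable {G X : Type*} [Group G] [MulAction G X] [MeasurableSpace X] [MeasurableConstSMul G X]
  (m : Measure X) [SMulInvariantMeasure G X m]

theorem koopman_coe (g : G) (f : Lp ℂ 2 m) : koopman m g f =ᵐ[m] fun x => f (g⁻¹ • x) :=
  Lp.coeFn_compMeasurePreserving f (measurePreserving_smul g⁻¹ m)

theorem koopman_koopman (g h : G) (f : Lp ℂ 2 m) :
    koopman m g (koopman m h f) = koopman m (g * h) f := by
  refine Lp.ext ?_
  have h1 := (measurePreserving_smul g⁻¹ m).quasiMeasurePreserving.ae_eq_comp (koopman_coe m h f)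
  filter_upwards [koopman_coe m g (koopman m h f), koopman_coe m (g * h) f, h1] with x h2 h3 h4
  rw [h2, h3, _root_.mul_inv_rev, mul_smul]
  exact h4

variable [IsFiniteMeasure m]

theorem koopman_const (g : G) (c : ℂ) : koopman m g (Lp.const 2 m c) = Lp.const 2 m c := by
  refine Lp.ext ?_
  have h1 := (measurePreserving_smul g⁻¹ m).quasiMeasurePreserving.ae_eq_comp
    (Lp.coeFn_const 2 m c)
  filter_upwards [koopman_coe m g (Lp.const 2 m c), Lp.coeFn_const 2 m c, h1] with x h2 h3 h4
  rw [h2, h3]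
  exact h4

theorem koopman_mem_LTwoZero (g : G) {f : Lp ℂ 2 m} (hf : f ∈ LTwoZero m) :
    koopman m g f ∈ LTwoZero m := by
  rw [LTwoZero, Submodule.mem_orthogonal_singleton_iff_inner_right] at hf ⊢
  rw [← koopman_const m g, LinearIsometry.inner_map_map, hf]

end Koopman

section Lp

variable {X : Type*} [MeasurableSpace X] {m : Measure X}

theorem enorm_sq_eq_lintegral (f : Lp ℂ 2 m) : ‖f‖ₑ ^ 2 = ∫⁻ x, ‖f x‖ₑ ^ 2 ∂m := by
  have h := eLpNorm_nnreal_pow_eq_lintegral (f := f) (μ := m) (p := 2) two_ne_zero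
  rw [Lp.enorm_def]
  simpa only [ENNReal.rpow_ofNat, NNReal.coe_ofNat, ENNReal.coe_ofNat] using h

/-- Pythagoras: `f` is orthogonal to constants. This lets the Hardy inequality be normalized by the
value at level `0` rather than by the mean. -/
theorem norm_le_norm_sub_smul_const [IsFiniteMeasure m] {f : Lp ℂ 2 m} (hf : f ∈ LTwoZero m)
    (c : ℂ) : ‖f‖ ≤ ‖f - Lp.const 2 m c‖ := by
  have hc : Lp.const 2 m c = c • Lp.const 2 m (1 : ℂ) := by
    simpa using (Lp.constₗ 2 m ℂ).map_smul c (1 : ℂ)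
  rw [LTwoZero, Submodule.mem_orthogonal_singleton_iff_inner_left] at hf
  have h := norm_sub_sq (𝕜 := ℂ) f (Lp.const 2 m c)
  rw [hc, inner_smul_right, hf, mul_zero, map_zero, ← hc] at h
  refine le_of_sq_le_sq ?_ (norm_nonneg _)
  nlinarith [sq_nonneg ‖Lp.const 2 m c‖]

end Lp

/-! ### The spectral gap -/

section Gap

variable {F : Type*} [Field F] [Fintype F] (m : Measure (CosetSpace (Γ F)))
  [SMulInvariantMeasure (G F) (CosetSpace (Γ F)) m] [IsFiniteMeasure m]

/-- A `K`-invariant square integrable function is a function of the level. -/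
theorem exists_ae_eq_comp_ylevel {φ : Lp ℂ 2 m} (hφ : ∀ k ∈ K F, koopman m k φ = φ) :
    ∃ ψ : ℕ → ℂ, φ =ᵐ[m] fun y => ψ (ylevel y) := by
  have := CosetSpace.continuousSMul (Λ := Γ F)
  set μ : Measure (G F) := Measure.haar
  have hmeas : Measurable (φ : CosetSpace (Γ F) → ℂ) := (Lp.stronglyMeasurable φ).measurable
  have hset : MeasurableSet {p : G F × CosetSpace (Γ F) | p.1 ∈ K F → φ (p.1⁻¹ • p.2) = φ p.2} := by
    have h1 : Measurable fun p : G F × CosetSpace (Γ F) => p.1⁻¹ • p.2 :=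
      (measurable_fst.inv).smul measurable_snd
    have h2 := measurableSet_eq_fun (hmeas.comp h1) (hmeas.comp measurable_snd)
    have h3 : MeasurableSet {p : G F × CosetSpace (Γ F) | p.1 ∈ K F} :=
      measurable_fst isOpen_K.measurableSet
    exact h3.imp h2
  -- Fubini turns invariance under each `k`, almost everywhere in `y`, into invariance at almost
  -- every `y` for almost all `g ∈ K`.
  have hae : ∀ᵐ y ∂m, ∀ᵐ g ∂μ, g ∈ K F → φ (g⁻¹ • y) = φ y := by
    refine (Measure.ae_ae_comm hset).1 (Filter.Eventually.of_forall fun g => ?_)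
    by_cases hg : g ∈ K F
    · have h := koopman_coe m g φ
      rw [hφ g hg] at h
      filter_upwards [h] with y hy _ using hy.symm
    · exact Filter.Eventually.of_forall fun y h => absurd h hg
  -- If `z = k • y`, positivity of the Haar measure of `K` provides one `g` good for `y` with `k g`
  -- good for `z`; then `φ y = φ (g⁻¹ • y) = φ ((k g)⁻¹ • z) = φ z`.
  have hconst : ∀ y z, (∀ᵐ g ∂μ, g ∈ K F → φ (g⁻¹ • y) = φ y) →
      (∀ᵐ g ∂μ, g ∈ K F → φ (g⁻¹ • z) = φ z) → ylevel y = ylevel z → φ y = φ z := by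
    intro y z hy hz h
    obtain ⟨k, hk, rfl⟩ := exists_smul_of_ylevel_eq h
    have hz' := (measurePreserving_mul_left μ k).quasiMeasurePreserving.ae hz
    have hpos : μ (K F : Set (G F)) ≠ 0 := (isOpen_K.measure_pos _ ⟨1, one_mem _⟩).ne'
    obtain ⟨g, hg, h1, h2⟩ := ((frequently_ae_mem_iff.2 hpos).and_eventually (hy.and hz')).exists
    have h3 := h2 (mul_mem hk hg)
    rw [_root_.mul_inv_rev, mul_smul, inv_smul_smul] at h3
    rw [← h1 hg, h3]
  classical
  refine ⟨fun n => if h : ∃ y, (∀ᵐ g ∂μ, g ∈ K F → φ (g⁻¹ • y) = φ y) ∧ ylevel y = n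
    then φ h.choose else 0, ?_⟩
  filter_upwards [hae] with y hy
  have h : ∃ z, (∀ᵐ g ∂μ, g ∈ K F → φ (g⁻¹ • z) = φ z) ∧ ylevel z = ylevel y := ⟨y, hy, rfl⟩
  rw [dif_pos h]
  exact hconst _ _ hy h.choose_spec.1 h.choose_spec.2.symm

theorem norm_le_of_fixed {φ : Lp ℂ 2 m} (hφ0 : φ ∈ LTwoZero m)
    (hφ : ∀ k ∈ K F, koopman m k φ = φ) :
    ‖φ‖ ≤ 6 * ((Fintype.card F : ℝ) + 1) * ‖koopman m (a F) φ - φ‖ := by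
  obtain ⟨ψ, hψ⟩ := exists_ae_eq_comp_ylevel m hφ
  have hD : ‖koopman m (a F) φ - φ‖ₑ ^ 2 =
      ∫⁻ y, ‖ψ (ylevel ((a F)⁻¹ • y)) - ψ (ylevel y)‖ₑ ^ 2 ∂m := by
    rw [enorm_sq_eq_lintegral]
    have h1 := (measurePreserving_smul (a F)⁻¹ m).quasiMeasurePreserving.ae_eq_comp hψ
    refine lintegral_congr_ae ?_
    filter_upwards [Lp.coeFn_sub (koopman m (a F) φ) φ, koopman_coe m (a F) φ, hψ, h1]
      with y h2 h3 h4 h5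
    have h6 : φ ((a F)⁻¹ • y) = ψ (ylevel ((a F)⁻¹ • y)) := h5
    rw [h2, Pi.sub_apply, h3, h4, h6]
  have hE : ‖φ - Lp.const 2 m (ψ 0)‖ₑ ^ 2 = ∫⁻ y, ‖ψ (ylevel y) - ψ 0‖ₑ ^ 2 ∂m := by
    rw [enorm_sq_eq_lintegral]
    refine lintegral_congr_ae ?_
    filter_upwards [Lp.coeFn_sub φ (Lp.const 2 m (ψ 0)), Lp.coeFn_const 2 m (ψ 0), hψ]
      with y h2 h3 h4
    rw [h2, Pi.sub_apply, h3, h4, Function.const_apply]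
  have h := lintegral_enorm_sub_sq_le m ψ (by rw [← hE]; finiteness)
  rw [← hE, ← hD] at h
  have h' : ‖φ - Lp.const 2 m (ψ 0)‖₊ ^ 2 ≤
      6 * ((Fintype.card F : NNReal) + 1) * ‖koopman m (a F) φ - φ‖₊ ^ 2 := by
    simp only [enorm_eq_nnnorm] at h
    exact_mod_cast h
  have h'' : ‖φ - Lp.const 2 m (ψ 0)‖ ^ 2 ≤
      6 * ((Fintype.card F : ℝ) + 1) * ‖koopman m (a F) φ - φ‖ ^ 2 := by exact_mod_cast h'
  -- The squared inequality has constant `C = 6(q + 1) ≥ 1`, and `C ≤ C²` avoids a square root.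
  refine (norm_le_norm_sub_smul_const hφ0 (ψ 0)).trans (le_of_sq_le_sq (h''.trans ?_) (by positivity))
  rw [mul_pow]
  gcongr
  nlinarith [(Nat.cast_nonneg (Fintype.card F) : (0 : ℝ) ≤ Fintype.card F)]

theorem hasSpectralGapProperty [IsProbabilityMeasure m] : HasSpectralGapProperty (G F) m := by
  set C : ℝ := 6 * ((Fintype.card F : ℝ) + 1) with hC
  have hC0 : 0 < C := by positivity
  -- With `φ` the nearby `K`-fixed vector, `‖f‖ ≤ ‖φ‖ + ‖φ - f‖ ≤ C · 3σ + σ`, whence the constant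
  -- `3C + 1`.
  refine ⟨K F ∪ {a F}, isCompact_K.union isCompact_singleton, 1 / (3 * C + 1), by positivity,
    fun f hf => ?_⟩
  set σ := ⨆ s : ((K F : Set (G F)) ∪ {a F} : Set (G F)), ‖koopman m (s : G F) f - f‖ with hσ
  have hb : BddAbove (Set.range fun s : ((K F : Set (G F)) ∪ {a F} : Set (G F)) =>
      ‖koopman m (s : G F) f - f‖) := by
    refine ⟨2 * ‖f‖, ?_⟩
    rintro _ ⟨s, rfl⟩
    refine (norm_sub_le _ _).trans (le_of_eq ?_)
    rw [LinearIsometry.norm_map, two_mul]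
  have hle : ∀ s ∈ ((K F : Set (G F)) ∪ {a F} : Set (G F)), ‖koopman m s f - f‖ ≤ σ :=
    fun s hs => le_ciSup hb ⟨s, hs⟩
  obtain ⟨φ, hφ0, hφ, hφf⟩ := exists_fixed_of_norm_sub_le (fun k : K F => koopman m (k : G F))
    (fun i j => ⟨i * j, koopman_koopman m (i : G F) j⟩) (LTwoZero m)
    (Submodule.isClosed_orthogonal _) (f := f) (δ := σ)
    (fun k => koopman_mem_LTwoZero m _ hf) (fun k => hle k (.inl k.2))
  have h1 := norm_le_of_fixed m hφ0 fun k hk => hφ ⟨k, hk⟩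
  have h2 : ‖koopman m (a F) φ - φ‖ ≤ 3 * σ := by
    have h3 : koopman m (a F) φ - φ =
        koopman m (a F) (φ - f) + (koopman m (a F) f - f) - (φ - f) := by
      rw [map_sub]
      abel
    have h4 := hle (a F) (.inr rfl)
    have h5 := norm_sub_le (koopman m (a F) (φ - f) + (koopman m (a F) f - f)) (φ - f)
    have h6 := norm_add_le (koopman m (a F) (φ - f)) (koopman m (a F) f - f)
    rw [LinearIsometry.norm_map] at h6
    rw [h3]
    linarith
  have h3 : ‖f‖ ≤ ‖φ‖ + ‖φ - f‖ := by
    have := norm_sub_le φ (φ - f)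
    rwa [sub_sub_cancel] at this
  rw [one_div_mul_eq_div, div_le_iff₀ (by positivity)]
  nlinarith [mul_le_mul_of_nonneg_left h2 hC0.le]

end Gap

end SpectralGap

end

theorem proposition8p4 (F : Type*) [Field F] [Fintype F] :
    (min (((Fintype.card F : ℝ) - 1) / ((Fintype.card F : ℝ) + 1))
          (4 * (Fintype.card F : ℝ) ^ 2 /
            (((Fintype.card F : ℝ) + 1) * ((Fintype.card F : ℝ) ^ 2 - 1)))
        ≤ SpectralGap.cheegerConstant (SpectralGap.quotientMass F) (SpectralGap.quotientWalk F) ∧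
      0 < min (((Fintype.card F : ℝ) - 1) / ((Fintype.card F : ℝ) + 1))
          (4 * (Fintype.card F : ℝ) ^ 2 /
            (((Fintype.card F : ℝ) + 1) * ((Fintype.card F : ℝ) ^ 2 - 1)))) ∧
    (∃ m : MeasureTheory.Measure (SpectralGap.CosetSpace (SpectralGap.Γ F)),
      MeasureTheory.IsProbabilityMeasure m ∧
      MeasureTheory.SMulInvariantMeasure (SpectralGap.G F)
        (SpectralGap.CosetSpace (SpectralGap.Γ F)) m) ∧
    ∀ (m : MeasureTheory.Measure (SpectralGap.CosetSpace (SpectralGap.Γ F)))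
      [MeasureTheory.IsProbabilityMeasure m]
      [MeasureTheory.SMulInvariantMeasure (SpectralGap.G F)
        (SpectralGap.CosetSpace (SpectralGap.Γ F)) m],
      SpectralGap.HasSpectralGapProperty (SpectralGap.G F) m := by
  have hq := SpectralGap.two_le_card (F := F)
  -- The Cheeger bound holds with the first entry of the minimum alone; the second entry matters
  -- only for positivity.
  refine ⟨⟨(min_le_left _ _).trans SpectralGap.le_cheegerConstant_quotientWalk,
    lt_min (div_pos (by linarith) (by linarith)) (div_pos (by positivity)
      (mul_pos (by linarith) (by nlinarith)))⟩,
    SpectralGap.exists_invariant_probability, ?_⟩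
  intro m _ _
  exact SpectralGap.hasSpectralGapProperty m
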